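/- \begin{theorem} Let $G$ be a compact connected Lie group and $K$ a compact subgroup such that $G/K$ is a (compact) symmetric space, i.e. there is a continuous involutive automorphism $\sigma$ of $G$ such that $K$ is a finite-index subgroup of the fixed point group $\{g\in G:\sigma(g)=g\}$. Let $dg$, $dk$ denote the Haar probability measures of $G$ and $K$, and let $\mu$ be the $G$-invariant probability measure on $G/K$ (the image of $dg$). A spherical function of $G/K$ is a continuous function $\omega_\phi:G/K\to\mathbb{C}$ with $\omega_\phi(1)=1$ and $\int_K\omega_\phi(xky)\,dk=\omega_\phi(x)\,\omega_\phi(y)$ for all $x,y\in G$; $\dim(\phi)$ denotes the dimension of the space spanned by the $G$-translates of $\omega_\phi$; the trivial spherical function is the constant $1$. Let $\omega_\tau$ be a spherical function that is not real valued, and for each spherical function $\omega_\phi$ put \[ m_\phi[(\tau+\overline\tau)^2]=\left[\dim(\phi)\dim(\tau)^2\right]^{1/2}\,\mathrm{Re}\int_{G/K}\left(\omega_\tau+\overline{\omega_\tau}\right)^2\,\overline{\omega_\phi}\;d\mu . \] Fix $\alpha\in G\setminus K$ with $K\alpha K=K\alpha^{-1}K$ and $\omega_\tau(\alpha)\neq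 1$. Then $\omega_\phi(\alpha)$ is real for every spherical function $\omega_\phi$, only finitely many of the numbers $m_\phi[(\tau+\overline\tau)^2]$ are nonzero, and they are the coefficients of the expansion \[ (\omega_\tau+\overline{\omega_\tau})^2=\sum_\phi\left[\frac{\dim(\phi)}{\dim(\tau)^2}\right]^{1/2} m_\phi[(\tau+\overline\tau)^2]\;\omega_\phi . \] Let $W=\sqrt{\dim(\tau)/2}\,\left(\omega_\tau+\overline{\omega_\tau}\right)$, regarded as a random variable on $(G/K,\mu)$, and let $a=1-\omega_\tau(\alpha)$. Then for all real $x_0$, \begin{align*} \left|\mathbb{P}(W\le x_0)-\frac1{\sqrt{2\pi}}\int_{-\infty}^{x_0}e^{-x^2/2}\,dx\right| \le{}& \frac12\sqrt{\sum_{\phi}{}^{*}\; m_\phi[(\tau+\overline\tau)^2]^2\left[2-\frac1a\bigl(1-\omega_\phi(\alpha)\bigr)\right]^2}\\ &+\left[\frac1\pi\sum_\phi m_\phi[(\tau+\overline\tau)^2]^2\left(2-\frac3{2a}\bigl(1-\omega_\phi(\alpha)\bigr)\right)\right]^{1/4}, \end{align*} where the second sum is over all spherical functions of $G/K$ and the starred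 sum is over all of them except the trivial one. \end{theorem} -/

import Mathlib

open MeasureTheory
open scoped Manifold ContDiff ComplexConjugate

noncomputable section

namespace CompactSymmetric

/-- The Haar probability measure of a compact group. -/
def haarProb (G : Type*) [Group G] [TopologicalSpace G] [IsTopologicalGroup G] [CompactSpace G]
    [MeasurableSpace G] [BorelSpace G] : Measure G :=
  Measure.haarMeasure ⊤

/-- `K` is, up to finite index, the full group of fixed points of an involutive automorphism `σ`
of `G`. For a connected compact Lie group `G` and a compact subgroup `K`, this says that `(G, K)` is
a (Riemannian) symmetric pair, i.e. that `G ⧸ K` is a compact symmetric space. -/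
def IsSymmetricSubgroup {G : Type*} [Group G] [TopologicalSpace G] (K : Subgroup G) : Prop :=
  ∃ σ : G →* G, Continuous σ ∧ Function.Involutive σ ∧
    K ≤ σ.eqLocus (MonoidHom.id G) ∧ K.relIndex (σ.eqLocus (MonoidHom.id G)) ≠ 0

variable {G : Type*} [Group G] [TopologicalSpace G] [IsTopologicalGroup G] [CompactSpace G]
  [MeasurableSpace G] [BorelSpace G]

/-- The `G`-invariant probability measure on `G ⧸ K`: the image of the Haar probability measure. -/
def quotientHaar (K : Subgroup G) : Measure (G ⧸ K) :=
  (haarProb G).map (fun g : G => (g : G ⧸ K))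

/-- Spherical functions on `G ⧸ K`: continuous functions `f` with `f(1) = 1` and
`∫_K f(x k y) dk = f(x) f(y)` for all `x, y` in `G`. -/
def IsSpherical (K : Subgroup G) [CompactSpace K] (f : C(G ⧸ K, ℂ)) : Prop :=
  f ((1 : G) : G ⧸ K) = 1 ∧
    ∀ x y : G, ∫ k : K, f ((x * (k : G) * y : G) : G ⧸ K) ∂(haarProb K) =
      f (x : G ⧸ K) * f (y : G ⧸ K)

/-- The set of all spherical functions of `G ⧸ K`, as a type. -/
abbrev SphericalFunction (K : Subgroup G) [CompactSpace K] : Type _ :=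
  {f : C(G ⧸ K, ℂ) // IsSpherical K f}

/-- The dimension of the `G`-invariant space of functions on `G ⧸ K` generated by `f`, that is, of
the linear span of all translates of `f`. -/
def sphDim {G : Type*} [Group G] [TopologicalSpace G] {K : Subgroup G} (f : C(G ⧸ K, ℂ)) : ℕ :=
  Module.finrank ℂ
    (Submodule.span ℂ (Set.range fun (g : G) (p : G ⧸ K) => f (g • p)))

/-- The multiplicity `m_φ[(τ + τ̄)^r]`, as a Fourier coefficient. -/
def mult {K : Subgroup G} (τ : C(G ⧸ K, ℂ)) (r : ℕ) (φ : C(G ⧸ K, ℂ)) : ℝ :=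
  √((sphDim φ : ℝ) * (sphDim τ : ℝ) ^ r) *
    (∫ p, (τ p + conj (τ p)) ^ r * conj (φ p) ∂(quotientHaar K)).re

/-- The random variable `W = √(dim τ / 2) (τ + τ̄)` on `G ⧸ K`. -/
def sphW {K : Subgroup G} (τ : C(G ⧸ K, ℂ)) (p : G ⧸ K) : ℝ :=
  √((sphDim τ : ℝ) / 2) * (τ p + conj (τ p)).re

end CompactSymmetric

end

/-! The bound is Stein's method for an exchangeable pair. For `x` Haar distributed put X = W(x) and
Y = W(xα). Because KαK = Kα⁻¹K, right `K`-invariant functions cannot distinguish (X, Y) from (Y, X)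
(`integral_mul_comp_mul_comm`). The functional equation of a spherical function says that ω_φ(xα),
averaged given the coset xK, is ω_φ(α)ω_φ(x). For τ this is the linear regression E[Y | xK] = (1 -
a)X. Applied termwise to the expansion of W², it turns the second moment of Y - X given xK, and the
fourth moment of Y - X, into finite sums over φ.

The analytic input `abs_measureReal_sub_cdf_le` bounds the distance to the Gaussian by 1/a times the
L² deviation of that conditional second moment from 2a, plus √(E|Y - X|³ / (a√(2π))). Orthogonality
of spherical functions controls the first term, and Cauchy–Schwarz reduces the third moment to the
second and fourth. The constant arises by replacing the indicator of (-∞, x₀] by a ramp of width δ: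
averaging the explicit Stein solutions for indicators gives a solution whose derivative is
1/δ-Lipschitz, and δ is then optimised.

The expansion itself is the harmonic analysis of a Gelfand pair, carried out on bi-invariant
functions lying in finite-dimensional translation-invariant spaces. Near 1 a polar decomposition
gives σ(g) = k g⁻¹ k with k in `K`. Connectedness propagates identities between matrix coefficients
(`matrixCoeff_eq_zero_of_eventually`), so σ acts on these functions as inversion, and Gelfand's
trick makes convolution commutative. Common eigenvectors of convolution are multiples of spherical
functions, which yields `IsGelfand.eq_sum`. Finally `IsSph.finrank_mul_nsq` identifies dim(φ) with
the inverse squared norm of ω_φ, converting norms into the multiplicities of the statement. -/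

section

open MeasureTheory Set Filter Topology

/-! ### Stein's method for the normal distribution: Gaussian tails -/

namespace SteinGauss

/-- The unnormalised Gaussian density. -/
noncomputable def dens (t : ℝ) : ℝ := Real.exp (-t ^ 2 / 2)

/-- The lower tail of the unnormalised Gaussian density. -/
noncomputable def low (w : ℝ) : ℝ := ∫ t in Iic w, dens t

/-- The upper tail of the unnormalised Gaussian density. -/
noncomputable def upp (w : ℝ) : ℝ := ∫ t in Ioi w, dens t

/-- The total mass of the unnormalised Gaussian density. -/
noncomputable def mass : ℝ := √(2 * Real.pi)

theorem mass_pos : 0 < mass := Real.sqrt_pos.2 (by positivity)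

theorem dens_pos (t : ℝ) : 0 < dens t := Real.exp_pos _

theorem dens_le_one (t : ℝ) : dens t ≤ 1 :=
  Real.exp_le_one_iff.2 (by nlinarith [sq_nonneg t])

theorem dens_neg (t : ℝ) : dens (-t) = dens t := by simp [dens]

theorem continuous_dens : Continuous dens := by unfold dens; fun_prop

theorem dens_eq (t : ℝ) : dens t = Real.exp (-(1 / 2) * t ^ 2) := by
  unfold dens; congr 1; ring

theorem integrable_dens : Integrable dens := by
  simpa only [← dens_eq] using integrable_exp_neg_mul_sq (b := 1 / 2) (by norm_num)

theorem integrable_mul_dens : Integrable fun t => t * dens t := by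
  simpa only [← dens_eq] using integrable_mul_exp_neg_mul_sq (b := 1 / 2) (by norm_num)

theorem integrable_sq_mul_dens : Integrable fun t => t ^ 2 * dens t := by
  have := integrable_rpow_mul_exp_neg_mul_sq (b := 1 / 2) (by norm_num) (s := 2) (by norm_num)
  simpa only [← dens_eq, Real.rpow_two] using this

theorem integral_dens : ∫ t, dens t = mass := by
  have := integral_gaussian (1 / 2)
  simp only [← dens_eq] at this
  rw [this, mass]
  congr 1
  ring

theorem hasDerivAt_dens (t : ℝ) : HasDerivAt dens (-(t * dens t)) t := by
  have h : HasDerivAt (fun t : ℝ => -t ^ 2 / 2) (-t) t := by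
    refine (((hasDerivAt_pow 2 t).neg).div_const 2).congr_deriv ?_
    norm_num
    ring
  exact h.exp.congr_deriv (by simp only [dens]; ring)

theorem tendsto_dens_atTop : Tendsto dens atTop (𝓝 0) := by
  apply tendsto_zero_of_hasDerivAt_of_integrableOn_Ioi (a := 0) (f' := fun t => -(t * dens t))
    (fun t _ => hasDerivAt_dens t) integrable_mul_dens.neg.integrableOn
    integrable_dens.integrableOn

theorem tendsto_mul_dens_atTop : Tendsto (fun t => t * dens t) atTop (𝓝 0) := by
  apply tendsto_zero_of_hasDerivAt_of_integrableOn_Ioi (a := 0)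
    (f' := fun t => 1 * dens t + t * (-(t * dens t)))
    (fun t _ => (hasDerivAt_id t).mul (hasDerivAt_dens t)) _
    integrable_mul_dens.integrableOn
  apply Integrable.integrableOn
  have := integrable_dens.sub integrable_sq_mul_dens
  refine this.congr (Eventually.of_forall fun t => ?_)
  simp only [Pi.sub_apply]
  ring

theorem low_add_upp (w : ℝ) : low w + upp w = mass := by
  rw [low, upp, ← integral_dens]
  exact intervalIntegral.integral_Iic_add_Ioi integrable_dens.integrableOn
    integrable_dens.integrableOn

theorem upp_neg (w : ℝ) : upp (-w) = low w := by
  rw [upp, low, ← integral_comp_neg_Iic]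
  simp [dens_neg]

theorem low_neg (w : ℝ) : low (-w) = upp w := by rw [← upp_neg, neg_neg]

theorem upp_nonneg (w : ℝ) : 0 ≤ upp w :=
  setIntegral_nonneg measurableSet_Ioi fun t _ => (dens_pos t).le

theorem low_nonneg (w : ℝ) : 0 ≤ low w := upp_neg w ▸ upp_nonneg _

theorem low_le_mass (w : ℝ) : low w ≤ mass := by linarith [low_add_upp w, upp_nonneg w]

theorem hasDerivAt_integral_Iic {g : ℝ → ℝ} (hg : Integrable g) (hc : Continuous g) (w : ℝ) :
    HasDerivAt (fun w => ∫ t in Iic w, g t) (g w) w := by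
  have h : (fun w => ∫ t in Iic w, g t) = fun w => (∫ t in Iic 0, g t) + ∫ t in (0 : ℝ)..w, g t := by
    funext w
    have := intervalIntegral.integral_Iic_sub_Iic (μ := volume) (a := 0) (b := w) (f := g)
      hg.integrableOn hg.integrableOn
    linarith
  rw [h]
  exact (intervalIntegral.integral_hasDerivAt_right hg.intervalIntegrable
    (hc.stronglyMeasurableAtFilter _ _) hc.continuousAt).const_add _

theorem hasDerivAt_low (w : ℝ) : HasDerivAt low (dens w) w :=
  hasDerivAt_integral_Iic integrable_dens continuous_dens w

theorem hasDerivAt_upp (w : ℝ) : HasDerivAt upp (-dens w) w := by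
  have h : upp = fun w => mass - low w := by funext w; linarith [low_add_upp w]
  rw [h]
  exact (hasDerivAt_low w).const_sub _

theorem low_mono : Monotone low :=
  monotone_of_hasDerivAt_nonneg hasDerivAt_low fun t => (dens_pos t).le

theorem upp_anti : Antitone upp := fun x y h => by
  linarith [low_add_upp x, low_add_upp y, low_mono h]

theorem continuous_low : Continuous low :=
  continuous_iff_continuousAt.2 fun w => (hasDerivAt_low w).continuousAt

theorem integral_Ioi_mul_dens (w : ℝ) : ∫ t in Ioi w, t * dens t = dens w := by
  have := integral_Ioi_of_hasDerivAt_of_tendsto' (a := w) (fun t _ => (hasDerivAt_dens t).neg)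
    (by simpa using integrable_mul_dens.integrableOn)
    (by simpa using tendsto_dens_atTop.neg : Tendsto (fun t => -dens t) _ _)
  simpa using this

theorem integral_Ioi_sq_mul_dens (w : ℝ) :
    ∫ t in Ioi w, t ^ 2 * dens t = w * dens w + upp w := by
  have := integral_Ioi_of_hasDerivAt_of_tendsto' (a := w)
    (f' := fun t => dens t - t ^ 2 * dens t) (f := fun t => t * dens t) (m := 0)
    (fun t _ => ((hasDerivAt_id t).mul (hasDerivAt_dens t)).congr_deriv (by simp; ring))
    (integrable_dens.sub integrable_sq_mul_dens).integrableOn tendsto_mul_dens_atTop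
  rw [integral_sub integrable_dens.integrableOn integrable_sq_mul_dens.integrableOn] at this
  rw [upp]
  linarith

theorem mul_upp_le (w : ℝ) : w * upp w ≤ dens w := by
  have h : 0 ≤ ∫ t in Ioi w, (t * dens t - w * dens t) :=
    setIntegral_nonneg measurableSet_Ioi fun t ht => by
      have : w < t := ht
      nlinarith [dens_pos t]
  rw [integral_sub integrable_mul_dens.integrableOn (integrable_dens.const_mul w).integrableOn,
    integral_Ioi_mul_dens, integral_const_mul] at h
  exact sub_nonneg.1 h

/-- Integrate `(t - w) ^ 2 * dens t ≥ 0` over the upper tail. This lower Mills bound is exactly the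
sign of the derivative of `mills`. -/
theorem mul_dens_le (w : ℝ) : w * dens w ≤ (1 + w ^ 2) * upp w := by
  have h : 0 ≤ ∫ t in Ioi w, (t ^ 2 * dens t - 2 * w * (t * dens t) + w ^ 2 * dens t) :=
    setIntegral_nonneg measurableSet_Ioi fun t ht => by
      nlinarith [mul_nonneg (sq_nonneg (t - w)) (dens_pos t).le]
  rw [integral_add, integral_sub integrable_sq_mul_dens.integrableOn
    (integrable_mul_dens.const_mul (2 * w)).integrableOn, integral_const_mul, integral_const_mul,
    integral_Ioi_mul_dens, integral_Ioi_sq_mul_dens] at h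
  · rw [← upp] at h
    nlinarith
  · exact (integrable_sq_mul_dens.sub (integrable_mul_dens.const_mul _)).integrableOn
  · exact (integrable_dens.const_mul _).integrableOn

/-- The Mills-type ratio `w e^{w²/2} ∫_w^∞ e^{-t²/2}`. -/
noncomputable def mills (w : ℝ) : ℝ := w * ((dens w)⁻¹ * upp w)

theorem hasDerivAt_inv_dens (w : ℝ) : HasDerivAt (fun t => (dens t)⁻¹) (w * (dens w)⁻¹) w := by
  refine ((hasDerivAt_dens w).inv (dens_pos w).ne').congr_deriv ?_
  have := (dens_pos w).ne'
  field_simp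

theorem mills_mono : Monotone mills := by
  have hd (w : ℝ) : HasDerivAt mills ((dens w)⁻¹ * ((1 + w ^ 2) * upp w - w * dens w)) w := by
    refine ((hasDerivAt_id w).mul ((hasDerivAt_inv_dens w).mul (hasDerivAt_upp w))).congr_deriv ?_
    have := (dens_pos w).ne'
    simp only [id, Pi.mul_apply]
    field_simp
    ring
  exact monotone_of_hasDerivAt_nonneg hd fun w =>
    mul_nonneg (inv_nonneg.2 (dens_pos w).le) (sub_nonneg.2 (mul_dens_le w))

theorem mills_le_one (w : ℝ) : mills w ≤ 1 := by
  have h := mul_upp_le w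
  rw [mills, mul_left_comm, inv_mul_le_iff₀ (dens_pos w)]
  simpa using h

/-- The solution of Stein's equation for the indicator function of `(-∞, z]`. -/
noncomputable def ker (z w : ℝ) : ℝ := mass⁻¹ * ((dens w)⁻¹ * (low (min w z) * upp (max w z)))

theorem ker_nonneg (z w : ℝ) : 0 ≤ ker z w := by
  unfold ker
  have := dens_pos w
  have := mass_pos
  have := low_nonneg (min w z)
  have := upp_nonneg (max w z)
  positivity

/-- On either side of `z` the function is a nonnegative constant times `mills w` or `-mills (-w)`,
and the two pieces meet at `z`. Monotonicity is what lets increments be bounded by integrating over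
all `z` in `mul_sol_sub_mem`. -/
theorem mul_ker_mono (z : ℝ) : Monotone fun w => w * ker z w := by
  have hm := inv_nonneg.2 mass_pos.le
  have h1 : MonotoneOn (fun w => w * ker z w) (Iic z) := by
    intro x hx y hy hxy
    have e (w : ℝ) (hw : w ≤ z) : w * ker z w = mass⁻¹ * upp z * -mills (-w) := by
      rw [ker, min_eq_left hw, max_eq_right hw, mills, upp_neg, dens_neg]; ring
    simp only [e x hx, e y hy]
    refine mul_le_mul_of_nonneg_left (neg_le_neg (mills_mono (neg_le_neg hxy)))
      (mul_nonneg hm (upp_nonneg z))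
  have h2 : MonotoneOn (fun w => w * ker z w) (Ici z) := by
    intro x hx y hy hxy
    have e (w : ℝ) (hw : z ≤ w) : w * ker z w = mass⁻¹ * low z * mills w := by
      rw [ker, min_eq_right hw, max_eq_left hw, mills]; ring
    simp only [e x hx, e y hy]
    exact mul_le_mul_of_nonneg_left (mills_mono hxy) (mul_nonneg hm (low_nonneg z))
  exact h1.Iic_union_Ici h2

theorem abs_mul_ker_le_one (z w : ℝ) : |w * ker z w| ≤ 1 := by
  have hm := inv_nonneg.2 mass_pos.le
  have key (w z : ℝ) (hw : 0 ≤ w) : w * ker z w ≤ 1 := by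
    have hd := (dens_pos w)
    calc w * ker z w ≤ w * (mass⁻¹ * ((dens w)⁻¹ * (mass * upp w))) := by
          unfold ker
          gcongr
          · exact upp_nonneg _
          · exact mass_pos.le
          · exact low_le_mass _
          · exact upp_anti (le_max_left _ _)
      _ = mills w := by
          have := mass_pos.ne'
          rw [mills]; field_simp
      _ ≤ 1 := mills_le_one w
  -- Reflection exchanges the two tails, so negative `w` reduces to `key`.
  have hsymm (w z : ℝ) : ker (-z) (-w) = ker z w := by
    rw [ker, ker, dens_neg, min_neg_neg, max_neg_neg, low_neg, upp_neg]; ring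
  rw [abs_mul, abs_of_nonneg (ker_nonneg z w)]
  rcases le_total 0 w with hw | hw
  · rw [abs_of_nonneg hw]; exact key w z hw
  · rw [abs_of_nonpos hw, ← hsymm]; exact key (-w) (-z) (by linarith)

theorem hasDerivAt_mul_upp_sub_dens (z : ℝ) :
    HasDerivAt (fun z => z * upp z - dens z) (upp z) z :=
  (((hasDerivAt_id z).mul (hasDerivAt_upp z)).sub (hasDerivAt_dens z)).congr_deriv (by simp)

theorem tendsto_mul_upp_sub_dens : Tendsto (fun z => z * upp z - dens z) atTop (𝓝 0) := by
  have h : Tendsto (fun z => z * upp z) atTop (𝓝 0) := by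
    refine tendsto_of_tendsto_of_tendsto_of_le_of_le' tendsto_const_nhds tendsto_dens_atTop ?_
      (Eventually.of_forall mul_upp_le)
    filter_upwards [eventually_ge_atTop 0] with z hz using mul_nonneg hz (upp_nonneg z)
  simpa using h.sub tendsto_dens_atTop

theorem integrableOn_upp (w : ℝ) : IntegrableOn upp (Ioi w) :=
  integrableOn_Ioi_deriv_of_nonneg' (fun z _ => hasDerivAt_mul_upp_sub_dens z)
    (fun z _ => upp_nonneg z) tendsto_mul_upp_sub_dens

theorem integral_upp (w : ℝ) : ∫ z in Ioi w, upp z = dens w - w * upp w := by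
  rw [integral_Ioi_of_hasDerivAt_of_nonneg' (fun z _ => hasDerivAt_mul_upp_sub_dens z)
    (fun z _ => upp_nonneg z) tendsto_mul_upp_sub_dens]
  ring

theorem integrableOn_low (w : ℝ) : IntegrableOn low (Iic w) := by
  have h : IntegrableOn upp (Ici (-w)) :=
    (integrableOn_Ici_iff_integrableOn_Ioi (by simp)).2 (integrableOn_upp _)
  simpa [upp_neg] using h.comp_neg

theorem integral_low (w : ℝ) : ∫ z in Iic w, low z = dens w + w * low w := by
  have := integral_comp_neg_Iic w upp
  simp only [upp_neg, integral_upp, dens_neg] at this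
  rw [this]; ring

theorem ker_of_le {z w : ℝ} (h : z ≤ w) : ker z w = mass⁻¹ * ((dens w)⁻¹ * upp w) * low z := by
  rw [ker, min_eq_right h, max_eq_left h]; ring

theorem ker_of_ge {z w : ℝ} (h : w ≤ z) : ker z w = mass⁻¹ * ((dens w)⁻¹ * low w) * upp z := by
  rw [ker, min_eq_left h, max_eq_right h]; ring

theorem integrableOn_ker_Iic (w : ℝ) : IntegrableOn (fun z => ker z w) (Iic w) :=
  IntegrableOn.congr_fun ((integrableOn_low w).const_mul _) (fun _ hz => (ker_of_le hz).symm)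
    measurableSet_Iic

theorem integrableOn_ker_Ioi (w : ℝ) : IntegrableOn (fun z => ker z w) (Ioi w) :=
  IntegrableOn.congr_fun ((integrableOn_upp w).const_mul _) (fun _ hz => (ker_of_ge (le_of_lt hz)).symm)
    measurableSet_Ioi

theorem integrable_ker (w : ℝ) : Integrable (fun z => ker z w) := by
  rw [← integrableOn_univ, ← Iic_union_Ioi (a := w)]
  exact (integrableOn_ker_Iic w).union (integrableOn_ker_Ioi w)

/-- Integrating the right side of Stein's equation over all thresholds `z` gives `-w`, and the
constant 1 solves `f' - w f = -w`. The proof computes both halves from the tail integrals. -/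
theorem integral_ker (w : ℝ) : ∫ z, ker z w = 1 := by
  rw [← intervalIntegral.integral_Iic_add_Ioi (integrableOn_ker_Iic w) (integrableOn_ker_Ioi w),
    setIntegral_congr_fun measurableSet_Iic (fun z hz => ker_of_le hz),
    setIntegral_congr_fun measurableSet_Ioi (fun z hz => ker_of_ge (le_of_lt hz)),
    integral_const_mul, integral_const_mul, integral_low, integral_upp]
  have h := low_add_upp w
  have hm := mass_pos.ne'
  have hd := (dens_pos w).ne'
  field_simp
  linear_combination dens w * h

/-! ### Smoothed indicator functions -/

/-- The cumulative distribution function of the standard Gaussian measure. -/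
noncomputable def cdf (z : ℝ) : ℝ := mass⁻¹ * low z

theorem cdf_nonneg (z : ℝ) : 0 ≤ cdf z := mul_nonneg (inv_nonneg.2 mass_pos.le) (low_nonneg z)

theorem cdf_le_one (z : ℝ) : cdf z ≤ 1 := by
  rw [cdf, inv_mul_le_iff₀ mass_pos, mul_one]; exact low_le_mass z

theorem continuous_cdf : Continuous cdf := continuous_low.const_mul _

theorem hasDerivAt_cdf (z : ℝ) : HasDerivAt cdf (mass⁻¹ * dens z) z :=
  (hasDerivAt_low z).const_mul _

theorem cdf_sub_le {x y : ℝ} (h : x ≤ y) : cdf y - cdf x ≤ mass⁻¹ * (y - x) := by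
  have hm := inv_nonneg.2 mass_pos.le
  have : Monotone fun z => mass⁻¹ * z - cdf z := by
    refine monotone_of_hasDerivAt_nonneg
      (fun z => ((hasDerivAt_id z).const_mul _).sub (hasDerivAt_cdf z)) fun z => ?_
    have := mul_le_mul_of_nonneg_left (dens_le_one z) hm
    simp only [Pi.zero_apply]
    linarith
  have := this h
  simp only at this
  linarith

/-- The indicator function of `[t, ∞)` evaluated at `z`. -/
noncomputable def step (t z : ℝ) : ℝ := (Ici t).indicator 1 z

theorem step_nonneg (t z : ℝ) : 0 ≤ step t z := indicator_nonneg (fun _ _ => zero_le_one) z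

theorem step_le_one (t z : ℝ) : step t z ≤ 1 := indicator_le' (fun _ _ => le_rfl) (by simp) z

theorem measurable_step : Measurable fun p : ℝ × ℝ => step p.1 p.2 := by
  have : (fun p : ℝ × ℝ => step p.1 p.2) = {p : ℝ × ℝ | p.1 ≤ p.2}.indicator 1 := by
    funext p
    simp [step, indicator]
  rw [this]
  exact measurable_one.indicator (measurableSet_le measurable_fst measurable_snd)

/-- Stein's equation for an indicator in integrated form. It holds at every `w`, including the jump
at `z`, where the differential equation fails. -/
theorem integral_step_sub_cdf (z w : ℝ) :
    ∫ t in Iic w, (step t z - cdf z) * dens t = dens w * ker z w := by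
  have hs (t : ℝ) : step t z * dens t = (Iic z).indicator dens t := by
    by_cases h : t ≤ z <;> simp [step, indicator, h]
  have hi : Integrable fun t => step t z * dens t := by
    simp only [hs]
    exact integrable_dens.indicator measurableSet_Iic
  have hm := mass_pos.ne'
  have hd := (dens_pos w).ne'
  simp only [sub_mul]
  rw [integral_sub hi.integrableOn (integrable_dens.const_mul _).integrableOn, integral_const_mul]
  simp only [hs]
  rw [setIntegral_indicator measurableSet_Iic, Iic_inter_Iic, ker, cdf]
  change low (w ⊓ z) - mass⁻¹ * low z * low w = _
  rcases le_total w z with h | h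
  · rw [min_eq_left h, max_eq_right h]
    have := low_add_upp z
    field_simp
    linear_combination low w * (-this)
  · rw [min_eq_right h, max_eq_left h]
    have := low_add_upp w
    field_simp
    linear_combination low z * (-this)

/-- The continuous piecewise linear function that is `1` on `(-∞, x]` and `0` on `[x + δ, ∞)`. -/
noncomputable def ramp (x δ t : ℝ) : ℝ := δ⁻¹ * ∫ z in Ioc x (x + δ), step t z

theorem integrableOn_step (t x y : ℝ) : IntegrableOn (step t) (Ioc x y) :=
  (integrable_const (1 : ℝ)).indicator measurableSet_Ici

theorem ramp_nonneg {x δ : ℝ} (hδ : 0 < δ) (t : ℝ) : 0 ≤ ramp x δ t :=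
  mul_nonneg (inv_nonneg.2 hδ.le) (setIntegral_nonneg measurableSet_Ioc fun _ _ => step_nonneg _ _)

theorem ramp_le_one {x δ : ℝ} (hδ : 0 < δ) (t : ℝ) : ramp x δ t ≤ 1 := by
  rw [ramp, inv_mul_le_iff₀ hδ, mul_one]
  calc _ ≤ ∫ z in Ioc x (x + δ), (1 : ℝ) :=
        setIntegral_mono_on (integrableOn_step _ _ _) (integrable_const _) measurableSet_Ioc
          fun _ _ => step_le_one _ _
    _ = δ := by simp [hδ.le]

theorem ramp_of_le {x δ t : ℝ} (hδ : 0 < δ) (h : t ≤ x) : ramp x δ t = 1 := by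
  have : ∫ z in Ioc x (x + δ), step t z = ∫ z in Ioc x (x + δ), (1 : ℝ) :=
    setIntegral_congr_fun measurableSet_Ioc fun z hz => by simp [step, h.trans hz.1.le]
  rw [ramp, this]
  simp [hδ.le, hδ.ne']

theorem ramp_of_lt {x δ t : ℝ} (h : x + δ < t) : ramp x δ t = 0 := by
  have : ∫ z in Ioc x (x + δ), step t z = ∫ z in Ioc x (x + δ), (0 : ℝ) :=
    setIntegral_congr_fun measurableSet_Ioc fun z hz => by simp [step, hz.2.trans_lt h]
  rw [ramp, this]
  simp

theorem ramp_sub_mem {x δ s t : ℝ} (hδ : 0 < δ) (h : s ≤ t) :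
    0 ≤ ramp x δ s - ramp x δ t ∧ ramp x δ s - ramp x δ t ≤ δ⁻¹ * (t - s) := by
  have e (z : ℝ) : step s z - step t z = (Ico s t).indicator 1 z := by
    by_cases h1 : s ≤ z <;> by_cases h2 : t ≤ z <;> simp [step, indicator, h1, h2]
    exact absurd (h.trans h2) h1
  rw [ramp, ramp, ← mul_sub, ← integral_sub (integrableOn_step _ _ _) (integrableOn_step _ _ _)]
  simp only [e]
  have hδ' := inv_nonneg.2 hδ.le
  refine ⟨mul_nonneg hδ' (setIntegral_nonneg measurableSet_Ioc fun _ _ =>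
    indicator_nonneg (fun _ _ => zero_le_one) _), mul_le_mul_of_nonneg_left ?_ hδ'⟩
  have hi : Integrable ((Ico s t).indicator (1 : ℝ → ℝ)) :=
    (integrable_indicator_iff measurableSet_Ico).2
      (integrableOn_const (C := (1 : ℝ)) (by simp))
  calc _ ≤ ∫ z, (Ico s t).indicator (1 : ℝ → ℝ) z :=
        setIntegral_le_integral hi (Eventually.of_forall (indicator_nonneg fun _ _ => zero_le_one))
    _ = t - s := by rw [integral_indicator_one measurableSet_Ico]; simp [h]

theorem abs_sub_le_of_le {g : ℝ → ℝ} {C : ℝ}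
    (h : ∀ s t, s ≤ t → |g s - g t| ≤ C * (t - s)) (s t : ℝ) : |g s - g t| ≤ C * |s - t| := by
  rcases le_total s t with hst | hst
  · rw [abs_sub_comm s t, abs_of_nonneg (sub_nonneg.2 hst)]; exact h s t hst
  · rw [abs_sub_comm (g s), abs_of_nonneg (sub_nonneg.2 hst)]; exact h t s hst

theorem continuous_of_abs_sub_le {g : ℝ → ℝ} {C : ℝ} (hC : 0 ≤ C)
    (h : ∀ s t, |g s - g t| ≤ C * |s - t|) : Continuous g :=
  (LipschitzWith.of_dist_le_mul (K := C.toNNReal) fun s t => by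
    simpa [Real.dist_eq, hC] using h s t).continuous

theorem continuous_ramp {x δ : ℝ} (hδ : 0 < δ) : Continuous (ramp x δ) :=
  continuous_of_abs_sub_le (inv_nonneg.2 hδ.le) <| abs_sub_le_of_le fun s t h => by
    rw [abs_of_nonneg (ramp_sub_mem hδ h).1]; exact (ramp_sub_mem hδ h).2

/-- The Gaussian mean of `ramp x δ`. -/
noncomputable def rampMean (x δ : ℝ) : ℝ := δ⁻¹ * ∫ z in Ioc x (x + δ), cdf z

theorem rampMean_nonneg {x δ : ℝ} (hδ : 0 < δ) : 0 ≤ rampMean x δ :=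
  mul_nonneg (inv_nonneg.2 hδ.le) (setIntegral_nonneg measurableSet_Ioc fun _ _ => cdf_nonneg _)

theorem integrableOn_cdf (x y : ℝ) : IntegrableOn cdf (Ioc x y) :=
  (continuous_cdf.integrableOn_Icc).mono_set Ioc_subset_Icc_self

theorem rampMean_le_one {x δ : ℝ} (hδ : 0 < δ) : rampMean x δ ≤ 1 := by
  rw [rampMean, inv_mul_le_iff₀ hδ, mul_one]
  calc _ ≤ ∫ z in Ioc x (x + δ), (1 : ℝ) :=
        setIntegral_mono_on (integrableOn_cdf _ _) (integrable_const _) measurableSet_Ioc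
          fun _ _ => cdf_le_one _
    _ = δ := by simp [hδ.le]

/-- The Gaussian density is at most `mass⁻¹`, and the mean of `z - x` over the window is `δ / 2`;
averaging thus gains a factor 2 over the crude bound. -/
theorem rampMean_le {x δ : ℝ} (hδ : 0 < δ) : rampMean x δ ≤ cdf x + mass⁻¹ * (δ / 2) := by
  rw [rampMean, inv_mul_le_iff₀ hδ, ← intervalIntegral.integral_of_le (by linarith)]
  calc ∫ z in x..x + δ, cdf z ≤ ∫ z in x..x + δ, (cdf x + mass⁻¹ * (z - x)) := by
        refine intervalIntegral.integral_mono_on (by linarith)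
          (continuous_cdf.intervalIntegrable _ _)
          (Continuous.intervalIntegrable (by fun_prop) _ _) fun z hz => ?_
        linarith [cdf_sub_le hz.1]
    _ = δ * (cdf x + mass⁻¹ * (δ / 2)) := by
        rw [intervalIntegral.integral_add (by simp) (Continuous.intervalIntegrable (by fun_prop) _ _),
          intervalIntegral.integral_const_mul,
          intervalIntegral.integral_sub (by simp) (by simp)]
        simp
        ring

theorem le_rampMean {x δ : ℝ} (hδ : 0 < δ) : cdf (x + δ) - mass⁻¹ * (δ / 2) ≤ rampMean x δ := by
  rw [rampMean, le_inv_mul_iff₀ hδ, ← intervalIntegral.integral_of_le (by linarith)]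
  calc δ * (cdf (x + δ) - mass⁻¹ * (δ / 2))
      = ∫ z in x..x + δ, (cdf (x + δ) - mass⁻¹ * (x + δ - z)) := by
        rw [intervalIntegral.integral_sub (by simp) (Continuous.intervalIntegrable (by fun_prop) _ _),
          intervalIntegral.integral_const_mul,
          intervalIntegral.integral_sub (by simp) (by simp)]
        simp
        ring
    _ ≤ ∫ z in x..x + δ, cdf z := by
        refine intervalIntegral.integral_mono_on (by linarith)
          (Continuous.intervalIntegrable (by fun_prop) _ _)
          (continuous_cdf.intervalIntegrable _ _) fun z hz => ?_
        linarith [cdf_sub_le hz.2]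

/-! ### The smoothed Stein equation and the exchangeable pair bound -/

/-- The solution of Stein's equation for `ramp x δ`. -/
noncomputable def sol (x δ w : ℝ) : ℝ := δ⁻¹ * ∫ z in Ioc x (x + δ), ker z w

theorem dens_mul_sol (x δ w : ℝ) :
    dens w * sol x δ w = ∫ t in Iic w, (ramp x δ t - rampMean x δ) * dens t := by
  have hint : Integrable (Function.uncurry fun t z => (step t z - cdf z) * dens t)
      ((volume.restrict (Iic w)).prod (volume.restrict (Ioc x (x + δ)))) := by
    have h1 : Integrable (fun p : ℝ × ℝ => dens p.1 * 1)
        ((volume.restrict (Iic w)).prod (volume.restrict (Ioc x (x + δ)))) :=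
      Integrable.mul_prod integrable_dens.integrableOn (integrable_const 1)
    refine h1.mono' ?_ (Eventually.of_forall fun p => ?_)
    · exact ((measurable_step.sub (continuous_cdf.measurable.comp measurable_snd)).mul
        (continuous_dens.measurable.comp measurable_fst)).aestronglyMeasurable
    · have h2 : |step p.1 p.2 - cdf p.2| ≤ 1 :=
        abs_sub_le_of_nonneg_of_le (step_nonneg _ _) (step_le_one _ _) (cdf_nonneg _) (cdf_le_one _)
      have hd := dens_pos p.1
      simp only [Function.uncurry, norm_mul, Real.norm_eq_abs, abs_of_pos hd]
      nlinarith
  have e (t : ℝ) : (ramp x δ t - rampMean x δ) * dens t =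
      δ⁻¹ * ∫ z in Ioc x (x + δ), (step t z - cdf z) * dens t := by
    rw [integral_mul_const, integral_sub (integrableOn_step _ _ _) (integrableOn_cdf _ _), ramp,
      rampMean]
    ring
  simp only [e]
  rw [integral_const_mul, integral_integral_swap hint]
  simp only [integral_step_sub_cdf]
  rw [integral_const_mul, sol]
  ring

theorem hasDerivAt_sol {x δ : ℝ} (hδ : 0 < δ) (w : ℝ) :
    HasDerivAt (sol x δ) (w * sol x δ w + (ramp x δ w - rampMean x δ)) w := by
  have hc : Continuous fun t => (ramp x δ t - rampMean x δ) * dens t := by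
    have := continuous_ramp (x := x) hδ
    have := continuous_dens
    fun_prop
  have hi : Integrable fun t => (ramp x δ t - rampMean x δ) * dens t := by
    refine integrable_dens.mono' hc.aestronglyMeasurable (Eventually.of_forall fun t => ?_)
    have h2 : |ramp x δ t - rampMean x δ| ≤ 1 := abs_sub_le_of_nonneg_of_le (ramp_nonneg hδ _)
      (ramp_le_one hδ _) (rampMean_nonneg hδ) (rampMean_le_one hδ)
    have hd := dens_pos t
    simp only [norm_mul, Real.norm_eq_abs, abs_of_pos hd]
    nlinarith
  have e : sol x δ = fun w => (dens w)⁻¹ * ∫ t in Iic w, (ramp x δ t - rampMean x δ) * dens t := by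
    funext w
    rw [← dens_mul_sol x δ w, inv_mul_cancel_left₀ (dens_pos w).ne']
  have := (hasDerivAt_inv_dens w).mul (hasDerivAt_integral_Iic hi hc w)
  rw [e]
  refine this.congr_deriv ?_
  have := (dens_pos w).ne'
  field_simp

theorem abs_mul_sol_le_one {x δ : ℝ} (hδ : 0 < δ) (w : ℝ) : |w * sol x δ w| ≤ 1 := by
  rw [sol, mul_left_comm, abs_mul, abs_of_pos (inv_pos.2 hδ), inv_mul_le_iff₀ hδ, mul_one,
    ← integral_const_mul]
  have := norm_setIntegral_le_of_norm_le_const (μ := volume) (s := Ioc x (x + δ)) (C := 1)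
    (f := fun z => w * ker z w) (by simp) (fun z _ => abs_mul_ker_le_one z w)
  simpa [hδ.le] using this

/-- The increments of `w * ker z w` are nonnegative, so their integral over the window is at most
that over all `z`, which is `t - s` by `integral_ker`. -/
theorem mul_sol_sub_mem {x δ s t : ℝ} (hδ : 0 < δ) (h : s ≤ t) :
    0 ≤ t * sol x δ t - s * sol x δ s ∧ t * sol x δ t - s * sol x δ s ≤ δ⁻¹ * (t - s) := by
  have hδ' := inv_nonneg.2 hδ.le
  have hi (w : ℝ) : Integrable fun z => w * ker z w := (integrable_ker w).const_mul w
  have e : t * sol x δ t - s * sol x δ s =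
      δ⁻¹ * ∫ z in Ioc x (x + δ), (t * ker z t - s * ker z s) := by
    rw [integral_sub (hi t).integrableOn (hi s).integrableOn, integral_const_mul,
      integral_const_mul, sol, sol]
    ring
  have hpos (z : ℝ) : 0 ≤ t * ker z t - s * ker z s := sub_nonneg.2 (mul_ker_mono z h)
  rw [e]
  refine ⟨mul_nonneg hδ' (setIntegral_nonneg measurableSet_Ioc fun z _ => hpos z),
    mul_le_mul_of_nonneg_left ?_ hδ'⟩
  calc _ ≤ ∫ z, (t * ker z t - s * ker z s) :=
        setIntegral_le_integral ((hi t).sub (hi s)) (Eventually.of_forall hpos)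
    _ = t - s := by
        rw [integral_sub (hi t) (hi s), integral_const_mul, integral_const_mul, integral_ker,
          integral_ker]
        ring

/-- The derivative of `sol x δ`. -/
noncomputable def sol' (x δ w : ℝ) : ℝ := w * sol x δ w + (ramp x δ w - rampMean x δ)

theorem abs_sol'_le_two {x δ : ℝ} (hδ : 0 < δ) (w : ℝ) : |sol' x δ w| ≤ 2 := by
  have h2 : |ramp x δ w - rampMean x δ| ≤ 1 := abs_sub_le_of_nonneg_of_le (ramp_nonneg hδ _)
    (ramp_le_one hδ _) (rampMean_nonneg hδ) (rampMean_le_one hδ)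
  have := abs_add_le (w * sol x δ w) (ramp x δ w - rampMean x δ)
  have := abs_mul_sol_le_one (x := x) hδ w
  unfold sol'
  linarith

/-- `sol'` is an increasing plus a decreasing function, each with slope at most `δ⁻¹`. Opposite
signs make the Lipschitz constants compete rather than add, so it is `δ⁻¹` and not `2 * δ⁻¹`. -/
theorem abs_sol'_sub_le {x δ : ℝ} (hδ : 0 < δ) :
    ∀ s t, |sol' x δ s - sol' x δ t| ≤ δ⁻¹ * |s - t| :=
  abs_sub_le_of_le fun s t h => by
    have h1 := ramp_sub_mem (x := x) hδ h
    have h2 := mul_sol_sub_mem (x := x) hδ h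
    unfold sol'
    rw [abs_le]
    constructor <;> linarith [h1.1, h1.2, h2.1, h2.2]

theorem continuous_sol' {x δ : ℝ} (hδ : 0 < δ) : Continuous (sol' x δ) :=
  continuous_of_abs_sub_le (inv_nonneg.2 hδ.le) (abs_sol'_sub_le hδ)

theorem continuous_sol {x δ : ℝ} (hδ : 0 < δ) : Continuous (sol x δ) :=
  continuous_iff_continuousAt.2 fun w => (hasDerivAt_sol hδ w).continuousAt

/-- The error in the first order Taylor expansion of the solution of Stein's equation. -/
theorem abs_sol_sub_sub_le {x δ : ℝ} (hδ : 0 < δ) (s t : ℝ) :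
    |sol x δ t - sol x δ s - (t - s) * sol' x δ s| ≤ δ⁻¹ * (t - s) ^ 2 := by
  have := Convex.norm_image_sub_le_of_norm_hasDerivWithin_le
    (f := fun u => sol x δ u - u * sol' x δ s) (f' := fun u => sol' x δ u - sol' x δ s)
    (s := uIcc s t) (x := s) (y := t) (C := δ⁻¹ * |t - s|)
    (fun u _ => by
      refine (((hasDerivAt_sol hδ u).sub
        ((hasDerivAt_id u).mul_const (sol' x δ s))).congr_deriv ?_).hasDerivWithinAt
      simp [sol'])
    (fun u hu => (abs_sol'_sub_le hδ u s).trans <| by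
      have := abs_sub_left_of_mem_uIcc hu
      have := inv_nonneg.2 hδ.le
      gcongr)
    (convex_uIcc s t) left_mem_uIcc right_mem_uIcc
  simp only [Real.norm_eq_abs] at this
  rw [mul_assoc, abs_mul_abs_self] at this
  convert this using 2 <;> ring

theorem Integrable.of_abs_le {Ω : Type*} [MeasurableSpace Ω] {P : Measure Ω} [IsProbabilityMeasure P]
    {X : Ω → ℝ} (hX : Measurable X) {C : ℝ} (hC : ∀ η, |X η| ≤ C) : Integrable X P :=
  Integrable.of_bound hX.aestronglyMeasurable C (Eventually.of_forall hC)

theorem abs_integral_mul_le_sqrt_mul_sqrt {Ω : Type*} [MeasurableSpace Ω] {P : Measure Ω}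
    {X Y : Ω → ℝ} (hX : MemLp X 2 P) (hY : MemLp Y 2 P) :
    ∫ η, |X η| * |Y η| ∂P ≤ √(∫ η, X η ^ 2 ∂P) * √(∫ η, Y η ^ 2 ∂P) := by
  have := integral_mul_norm_le_Lp_mul_Lq (μ := P) (f := X) (g := Y) (p := 2) (q := 2)
    Real.HolderConjugate.two_two (by simpa using hX) (by simpa using hY)
  simpa [Real.sqrt_eq_rpow] using this

/-- Stein's bound on the distance to the normal distribution from an exchangeable pair. -/
theorem abs_measureReal_sub_cdf_le {Ω : Type*} [MeasurableSpace Ω] (P : Measure Ω)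
    [IsProbabilityMeasure P] {X Y S : Ω → ℝ} {a B : ℝ} (ha : 0 < a)
    (hX : Measurable X) (hY : Measurable Y) (hS : Measurable S)
    (hXB : ∀ η, |X η| ≤ B) (hYB : ∀ η, |Y η| ≤ B) (hSB : ∀ η, |S η| ≤ B)
    (hexch : ∀ u v : ℝ → ℝ, Continuous u → Continuous v →
      ∫ η, u (X η) * v (Y η) ∂P = ∫ η, u (Y η) * v (X η) ∂P)
    (hlin : ∀ u : ℝ → ℝ, Continuous u →
      ∫ η, u (X η) * (Y η - X η) ∂P = -(a * ∫ η, X η * u (X η) ∂P))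
    (hquad : ∀ u : ℝ → ℝ, Continuous u →
      ∫ η, u (X η) * (Y η - X η) ^ 2 ∂P = ∫ η, u (X η) * S η ∂P) (x₀ : ℝ) :
    |P.real {η | X η ≤ x₀} - cdf x₀| ≤
      1 / a * √(∫ η, (S η - 2 * a) ^ 2 ∂P) +
        √(mass⁻¹ * ((∫ η, |Y η - X η| ^ 3 ∂P) / a)) := by
  have hB : 0 ≤ B := by
    obtain ⟨η⟩ : Nonempty Ω := P.nonempty_of_neZero
    exact (abs_nonneg _).trans (hXB η)
  -- integrability of continuous expressions in the bounded random variables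
  have hint (q : ℝ × ℝ × ℝ → ℝ) (hq : Continuous q) :
      Integrable (fun η => q (X η, Y η, S η)) P := by
    obtain ⟨C, hC⟩ := ((isCompact_Icc (a := -B) (b := B)).prod
      ((isCompact_Icc (a := -B) (b := B)).prod
        (isCompact_Icc (a := -B) (b := B)))).exists_bound_of_continuousOn hq.continuousOn
    refine Integrable.of_abs_le (hq.measurable.comp (hX.prodMk (hY.prodMk hS)))
      fun η => hC _ ⟨?_, ?_, ?_⟩
    · exact abs_le.1 (hXB η)
    · exact abs_le.1 (hYB η)
    · exact abs_le.1 (hSB η)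
  set V := √(∫ η, (S η - 2 * a) ^ 2 ∂P) with hV
  set T := ∫ η, |Y η - X η| ^ 3 ∂P with hT
  have hV0 : 0 ≤ V := Real.sqrt_nonneg _
  have hT0 : 0 ≤ T := integral_nonneg fun η => by positivity
  -- the smoothed estimate
  have smooth (x δ : ℝ) (hδ : 0 < δ) :
      |∫ η, ramp x δ (X η) ∂P - rampMean x δ| ≤ 1 / a * V + δ⁻¹ * (T / (2 * a)) := by
    set f := sol x δ
    set g := sol' x δ
    have hf : Continuous f := continuous_sol hδ
    have hg : Continuous g := continuous_sol' hδ
    have hr : Continuous (ramp x δ) := continuous_ramp hδ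
    have h1 : ∫ η, ramp x δ (X η) ∂P - rampMean x δ = ∫ η, (g (X η) - X η * f (X η)) ∂P := by
      have e (η : Ω) : g (X η) - X η * f (X η) = ramp x δ (X η) - rampMean x δ := by
        simp only [g, f, sol']; ring
      simp only [e]
      rw [integral_sub (hint (fun p => ramp x δ p.1) (by fun_prop)) (integrable_const _)]
      simp
    -- By exchangeability the left side is -2 E[f(X)(Y - X)], to which the regression property
    -- applies.
    have h2 : ∫ η, (Y η - X η) * (f (Y η) - f (X η)) ∂P = 2 * a * ∫ η, X η * f (X η) ∂P := by
      have e1 := hexch (fun t => t) f continuous_id hf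
      have e2 := hexch (fun t => t * f t) (fun _ => 1) (by fun_prop) (by fun_prop)
      have e3 := hlin f hf
      have i1 := hint (fun p => p.2.1 * f p.2.1) (by fun_prop)
      have i2 := hint (fun p => p.2.1 * f p.1) (by fun_prop)
      have i3 := hint (fun p => p.1 * f p.2.1) (by fun_prop)
      have i4 := hint (fun p => p.1 * f p.1) (by fun_prop)
      have e (η : Ω) : (Y η - X η) * (f (Y η) - f (X η)) =
          Y η * f (Y η) - Y η * f (X η) - (X η * f (Y η) - X η * f (X η)) := by ring
      have e' (η : Ω) : f (X η) * (Y η - X η) = Y η * f (X η) - X η * f (X η) := by ring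
      simp only [e'] at e3
      simp only [mul_one] at e2
      simp only [e]
      rw [integral_sub i2 i4] at e3
      have i12 := hint (fun p => p.2.1 * f p.2.1 - p.2.1 * f p.1) (by fun_prop)
      have i34 := hint (fun p => p.1 * f p.2.1 - p.1 * f p.1) (by fun_prop)
      rw [integral_sub i12 i34, integral_sub i1 i2, integral_sub i3 i4]
      linarith
    -- Expand f(Y) - f(X) to first order: the linear part sees only the conditional second moment
    -- `S`, and the remainder costs a third moment.
    have h3 : ∫ η, (g (X η) - X η * f (X η)) ∂P =
        (2 * a)⁻¹ * (∫ η, g (X η) * (2 * a - S η) ∂P -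
          ∫ η, (Y η - X η) * (f (Y η) - f (X η) - (Y η - X η) * g (X η)) ∂P) := by
      have e1 := hquad g hg
      have i1 := hint (fun p => (p.2.1 - p.1) * (f p.2.1 - f p.1)) (by fun_prop)
      have i2 := hint (fun p => g p.1 * (p.2.1 - p.1) ^ 2) (by fun_prop)
      have i3 := hint (fun p => g p.1) (by fun_prop)
      have i4 := hint (fun p => g p.1 * p.2.2) (by fun_prop)
      have i5 := hint (fun p => p.1 * f p.1) (by fun_prop)
      have e2 (η : Ω) : (Y η - X η) * (f (Y η) - f (X η) - (Y η - X η) * g (X η)) =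
          (Y η - X η) * (f (Y η) - f (X η)) - g (X η) * (Y η - X η) ^ 2 := by ring
      have e3 (η : Ω) : g (X η) * (2 * a - S η) = 2 * a * g (X η) - g (X η) * S η := by ring
      simp only [e2, e3]
      rw [integral_sub i3 i5, integral_sub i1 i2, integral_sub (i3.const_mul _) i4,
        integral_const_mul, h2, e1]
      field_simp
      ring
    have h4 : |∫ η, g (X η) * (2 * a - S η) ∂P| ≤ 2 * V := by
      have m1 : MemLp (fun _ : Ω => (1 : ℝ)) 2 P := memLp_const 1
      have m2 : MemLp (fun η => S η - 2 * a) 2 P :=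
        MemLp.of_bound (hS.sub_const _).aestronglyMeasurable (B + 2 * a)
          (Eventually.of_forall fun η => by
            have h := abs_sub (S η) (2 * a)
            have h' := hSB η
            rw [abs_of_pos (by linarith : (0 : ℝ) < 2 * a)] at h
            simpa using h.trans (by linarith))
      have cs := abs_integral_mul_le_sqrt_mul_sqrt m1 m2
      simp only [abs_one, one_mul, one_pow, integral_const, probReal_univ, one_smul,
        Real.sqrt_one, ← hV] at cs
      calc |∫ η, g (X η) * (2 * a - S η) ∂P| ≤ ∫ η, |g (X η) * (2 * a - S η)| ∂P :=
            abs_integral_le_integral_abs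
        _ ≤ ∫ η, 2 * |S η - 2 * a| ∂P := by
            refine integral_mono (hint (fun p => |g p.1 * (2 * a - p.2.2)|) (by fun_prop))
              (hint (fun p => 2 * |p.2.2 - 2 * a|) (by fun_prop)) fun η => ?_
            simp only [abs_mul, abs_sub_comm (2 * a)]
            exact mul_le_mul_of_nonneg_right (abs_sol'_le_two hδ _) (abs_nonneg _)
        _ ≤ 2 * V := by
            rw [integral_const_mul]
            linarith
    have h5 : |∫ η, (Y η - X η) * (f (Y η) - f (X η) - (Y η - X η) * g (X η)) ∂P| ≤ δ⁻¹ * T := by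
      calc _ ≤ ∫ η, |(Y η - X η) * (f (Y η) - f (X η) - (Y η - X η) * g (X η))| ∂P :=
            abs_integral_le_integral_abs
        _ ≤ ∫ η, δ⁻¹ * |Y η - X η| ^ 3 ∂P := by
            refine integral_mono
              (hint (fun p => |(p.2.1 - p.1) * (f p.2.1 - f p.1 - (p.2.1 - p.1) * g p.1)|)
                (by fun_prop)) (hint (fun p => δ⁻¹ * |p.2.1 - p.1| ^ 3) (by fun_prop)) fun η => ?_
            have := abs_sol_sub_sub_le (x := x) hδ (X η) (Y η)
            calc _ = |Y η - X η| * |f (Y η) - f (X η) - (Y η - X η) * g (X η)| := abs_mul _ _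
              _ ≤ |Y η - X η| * (δ⁻¹ * (Y η - X η) ^ 2) := by gcongr
              _ = δ⁻¹ * |Y η - X η| ^ 3 := by rw [← sq_abs (Y η - X η)]; ring
        _ = δ⁻¹ * T := by rw [integral_const_mul]
    rw [h1, h3, abs_mul, abs_of_pos (by positivity), inv_mul_le_iff₀ (by positivity)]
    refine (abs_sub _ _).trans ((add_le_add h4 h5).trans (le_of_eq ?_))
    field_simp
  -- comparison with the smoothed indicator function
  have key (δ : ℝ) (hδ : 0 < δ) : |P.real {η | X η ≤ x₀} - cdf x₀| ≤
      1 / a * V + (δ⁻¹ * (T / (2 * a)) + mass⁻¹ * (δ / 2)) := by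
    have hms : MeasurableSet {η | X η ≤ x₀} := measurableSet_le hX measurable_const
    have hr (x : ℝ) := hint (fun p => ramp x δ p.1)
      (by have := continuous_ramp (x := x) hδ; fun_prop)
    have hi : Integrable ({η | X η ≤ x₀}.indicator (1 : Ω → ℝ)) P :=
      (integrable_const (1 : ℝ)).indicator hms
    rw [← integral_indicator_one hms, abs_le]
    constructor
    · have h1 : ∫ η, ramp (x₀ - δ) δ (X η) ∂P ≤ ∫ η, {η | X η ≤ x₀}.indicator 1 η ∂P := by
        refine integral_mono (hr _) hi fun η => ?_
        by_cases h : X η ≤ x₀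
        · simpa [h] using ramp_le_one hδ _
        · simpa [h] using (ramp_of_lt (by simpa using h)).le
      have h2 := le_rampMean (x := x₀ - δ) hδ
      have h3 := (abs_le.1 (smooth (x₀ - δ) δ hδ)).1
      rw [sub_add_cancel] at h2
      linarith
    · have h1 : ∫ η, {η | X η ≤ x₀}.indicator 1 η ∂P ≤ ∫ η, ramp x₀ δ (X η) ∂P := by
        refine integral_mono hi (hr _) fun η => ?_
        by_cases h : X η ≤ x₀
        · simp [h, ramp_of_le hδ h]
        · simpa [h] using ramp_nonneg hδ _
      have h2 := rampMean_le (x := x₀) hδ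
      have h3 := (abs_le.1 (smooth x₀ δ hδ)).2
      linarith
  have hm := mass_pos
  -- If `T = 0` there is no optimal `δ`, so let `δ` tend to 0. Otherwise `δ = mass * R` equalises
  -- the two `δ`-dependent terms, each becoming `R / 2`.
  rcases hT0.eq_or_lt with h0 | h0
  · rw [← h0]
    simp only [zero_div, mul_zero, Real.sqrt_zero, add_zero]
    refine le_of_forall_pos_le_add fun ε hε => ?_
    have := key (2 * mass * ε) (by positivity)
    rw [← h0] at this
    refine this.trans (le_of_eq ?_)
    field_simp
    ring
  · set R := √(mass⁻¹ * (T / a)) with hR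
    have hR0 : 0 < R := Real.sqrt_pos.2 (by positivity)
    have hR2 : R ^ 2 = mass⁻¹ * (T / a) := Real.sq_sqrt (by positivity)
    refine (key (mass * R) (by positivity)).trans (le_of_eq ?_)
    congr 1
    have hTe : T = a * mass * R ^ 2 := by rw [hR2]; field_simp
    rw [hTe]
    field_simp
    ring

end SteinGauss

end

section

open Set Filter Topology
open scoped Pointwise

/-! ### Local structure of Lie groups, and connectedness -/

namespace LieLocal

section Squaring

variable {E : Type*} [NormedAddCommGroup E] [NormedSpace ℝ E]
  {G : Type*} [Group G] [TopologicalSpace G] [ChartedSpace E G]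
  [LieGroup 𝓘(ℝ, E) ∞ G]

/-- In the chart at `1` of a Lie group, squaring has derivative `2` at the base point. -/
theorem hasStrictFDerivAt_sq_chart :
    HasStrictFDerivAt
      (fun y : E => chartAt E (1 : G) ((chartAt E (1 : G)).symm y * (chartAt E (1 : G)).symm y))
      (ContinuousLinearEquiv.smulLeft (Units.mk0 (2 : ℝ) two_ne_zero) : E ≃L[ℝ] E).toContinuousLinearMap
      (chartAt E (1 : G) 1) := by
  set c := chartAt E (1 : G) with hc
  set e := c 1 with he
  have h1 : (1 : G) ∈ c.source := mem_chart_source E 1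
  have hs : c.symm e = 1 := c.left_inv h1
  have het : e ∈ c.target := c.map_source h1
  have hsymm : ContMDiffAt 𝓘(ℝ, E) 𝓘(ℝ, E) ∞ c.symm e :=
    (contMDiffOn_chart_symm (I := 𝓘(ℝ, E)) (n := ∞) (x := (1 : G))).contMDiffAt
      (c.open_target.mem_nhds het)
  have hmul : ContMDiffAt 𝓘(ℝ, E × E) 𝓘(ℝ, E) ∞
      (fun y : E × E => c.symm y.1 * c.symm y.2) (e, e) :=
    (hsymm.comp (e, e) contDiffAt_fst.contMDiffAt).mul
      (hsymm.comp (e, e) contDiffAt_snd.contMDiffAt)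
  have hm : ContDiffAt ℝ ∞ (fun y : E × E => c (c.symm y.1 * c.symm y.2)) (e, e) := by
    rw [← contMDiffAt_iff_contDiffAt]
    refine ContMDiffAt.comp (I' := 𝓘(ℝ, E)) (g := c) (e, e) ?_ hmul
    refine (contMDiffOn_chart (I := 𝓘(ℝ, E)) (n := ∞) (x := (1 : G))).contMDiffAt ?_
    simp only [hs, mul_one]
    exact c.open_source.mem_nhds h1
  obtain ⟨D, hD⟩ : ∃ D, HasStrictFDerivAt (fun y : E × E => c (c.symm y.1 * c.symm y.2)) D (e, e) :=
    ⟨_, hm.hasStrictFDerivAt (by simp)⟩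
  have hinl (v : E) : D (v, 0) = v := by
    have h2 := HasFDerivAt.comp (f := fun y : E => (y, e)) e hD.hasFDerivAt
      ((hasFDerivAt_id e).prodMk (hasFDerivAt_const e e))
    have h3 : HasFDerivAt (fun y : E => y) _ e := h2.congr_of_eventuallyEq <| by
      filter_upwards [c.open_target.mem_nhds het] with y hy
      simp [hs, c.right_inv hy]
    simpa using congrArg (fun A : E →L[ℝ] E => A v) (h3.unique (hasFDerivAt_id e))
  have hinr (v : E) : D (0, v) = v := by
    have h2 := HasFDerivAt.comp (f := fun y : E => (e, y)) e hD.hasFDerivAt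
      ((hasFDerivAt_const e e).prodMk (hasFDerivAt_id e))
    have h3 : HasFDerivAt (fun y : E => y) _ e := h2.congr_of_eventuallyEq <| by
      filter_upwards [c.open_target.mem_nhds het] with y hy
      simp [hs, c.right_inv hy]
    simpa using congrArg (fun A : E →L[ℝ] E => A v) (h3.unique (hasFDerivAt_id e))
  have h4 := HasStrictFDerivAt.comp (f := fun y : E => (y, y)) e hD
    ((hasStrictFDerivAt_id e).prodMk (hasStrictFDerivAt_id e))
  refine h4.congr_fderiv ?_
  ext v
  have : D (v, v) = D (v, 0) + D (0, v) := by rw [← map_add]; simp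
  simp [this, hinl, hinr, two_smul, Units.smul_def]

end Squaring

/-- The inverse function theorem applied to squaring, whose derivative 2 at the identity is
invertible. It supplies square roots near 1, replacing the exponential map. -/
theorem map_sq_nhds_one (E : Type*) [NormedAddCommGroup E] [NormedSpace ℝ E]
    [FiniteDimensional ℝ E] {G : Type*} [Group G] [TopologicalSpace G] [ChartedSpace E G]
    [LieGroup 𝓘(ℝ, E) ∞ G] [ContinuousMul G] : map (fun x : G => x * x) (𝓝 1) = 𝓝 1 := by
  set c := chartAt E (1 : G) with hc
  have h1 : (1 : G) ∈ c.source := mem_chart_source E 1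
  have hs : c.symm (c 1) = 1 := c.left_inv h1
  have hd := (hasStrictFDerivAt_sq_chart (E := E) (G := G)).map_nhds_eq_of_equiv
  rw [← hc] at hd
  simp only [hs, mul_one] at hd
  have hcont : ContinuousAt (fun x : G => x * x) 1 := (continuous_id.mul continuous_id).continuousAt
  have he : (fun x : G => x * x) =ᶠ[𝓝 1] c.symm ∘ (fun y => c (c.symm y * c.symm y)) ∘ c := by
    filter_upwards [c.open_source.mem_nhds h1,
      hcont.preimage_mem_nhds (by simpa using c.open_source.mem_nhds h1)] with x hx hx'
    simp [c.left_inv hx, c.left_inv hx']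
  rw [map_congr he, ← map_map, ← map_map, c.map_nhds_eq h1, hd,
    c.symm_map_nhds_eq h1]

theorem exists_injOn_sq (E : Type*) [NormedAddCommGroup E] [NormedSpace ℝ E]
    [FiniteDimensional ℝ E] {G : Type*} [Group G] [TopologicalSpace G] [ChartedSpace E G]
    [LieGroup 𝓘(ℝ, E) ∞ G] [ContinuousMul G] : ∃ U ∈ 𝓝 (1 : G), InjOn (fun x : G => x * x) U := by
  obtain ⟨r, hd⟩ : ∃ r : E → E, ∀ᶠ y in 𝓝 (chartAt E (1 : G) 1),
      r (chartAt E (1 : G) ((chartAt E (1 : G)).symm y * (chartAt E (1 : G)).symm y)) = y :=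
    ⟨_, (hasStrictFDerivAt_sq_chart (E := E) (G := G)).eventually_left_inverse⟩
  set c := chartAt E (1 : G)
  have h1 : (1 : G) ∈ c.source := mem_chart_source E 1
  refine ⟨_, inter_mem (c.open_source.mem_nhds h1) ((c.continuousAt h1).preimage_mem_nhds hd),
    fun x hx y hy hxy => ?_⟩
  have hx2 := hx.2
  have hy2 := hy.2
  simp only [mem_preimage, mem_ofPred_eq, c.left_inv hx.1, c.left_inv hy.1] at hx2 hy2
  have hxy' : x * x = y * y := hxy
  rw [hxy', hy2] at hx2
  rw [← c.left_inv hx.1, ← c.left_inv hy.1, hx2]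

/-- Near the identity, an involutive automorphism differs from inversion only by factors in a
closed subgroup of finite index of the fixed point group. -/
theorem eventually_exists_map_eq_mul_inv_mul (E : Type*) [NormedAddCommGroup E] [NormedSpace ℝ E]
    [FiniteDimensional ℝ E] {G : Type*} [Group G] [TopologicalSpace G] [ChartedSpace E G]
    [IsTopologicalGroup G] [LieGroup 𝓘(ℝ, E) ∞ G] {K : Subgroup G} (hK : IsClosed (K : Set G))
    {σ : G →* G} (hσ : Continuous σ) (hinv : Function.Involutive σ)
    (hidx : K.relIndex (σ.eqLocus (MonoidHom.id G)) ≠ 0) :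
    ∀ᶠ g in 𝓝 (1 : G), ∃ k ∈ K, σ g = k * g⁻¹ * k := by
  set H := σ.eqLocus (MonoidHom.id G) with hH
  obtain ⟨U, hU, hinj⟩ := exists_injOn_sq (G := G) E
  -- A closed subgroup of finite index is open, so fixed points of `σ` close to 1 already lie in
  -- `K`.
  have hopen : IsOpen ((K.subgroupOf H : Subgroup H) : Set H) := by
    have : (K.subgroupOf H).FiniteIndex := ⟨hidx⟩
    exact Subgroup.isOpen_of_isClosed_of_finiteIndex _ (hK.preimage continuous_subtype_val)
  obtain ⟨N, hN, hNK⟩ := isOpen_induced_iff.1 hopen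
  have hN1 : N ∈ 𝓝 (1 : G) := by
    refine hN.mem_nhds ?_
    have : (1 : H) ∈ Subtype.val ⁻¹' N := by rw [hNK]; exact one_mem _
    simpa using this
  have hmemK {k : G} (hk : k ∈ N) (hσk : σ k = k) : k ∈ K := by
    have : (⟨k, hσk⟩ : H) ∈ Subtype.val ⁻¹' N := hk
    rw [hNK] at this
    exact this
  have hp : ∀ᶠ q : G × G in 𝓝 1 ×ˢ 𝓝 1, q.1⁻¹ * q.2 ∈ N := by
    rw [← nhds_prod_eq]
    have : Continuous fun q : G × G => q.1⁻¹ * q.2 := by fun_prop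
    exact this.continuousAt.preimage_mem_nhds (by simpa using hN1)
  obtain ⟨A, hA, B, hB, hAB⟩ := eventually_prod_iff.1 hp
  have hσ1 : Tendsto σ (𝓝 1) (𝓝 1) := by simpa using hσ.tendsto 1
  have hinv1 : Tendsto (fun x : G => x⁻¹) (𝓝 1) (𝓝 1) := by
    simpa using (continuous_inv (G := G)).tendsto 1
  have hV : {p : G | A p ∧ σ p ∈ U ∧ p⁻¹ ∈ U} ∈ 𝓝 (1 : G) :=
    hA.and ((hσ1.eventually hU).and (hinv1.eventually hU))
  have hsq : (fun x : G => x * x) '' {p : G | A p ∧ σ p ∈ U ∧ p⁻¹ ∈ U} ∈ 𝓝 (1 : G) := by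
    rw [← map_sq_nhds_one (G := G) E]
    exact image_mem_map hV
  have hs : Tendsto (fun g => g * (σ g)⁻¹) (𝓝 1) (𝓝 1) := by
    have : Continuous fun g => g * (σ g)⁻¹ := by fun_prop
    simpa using this.tendsto 1
  filter_upwards [hs.eventually hsq, hB] with g ⟨p, ⟨hpA, hpσ, hpi⟩, hps⟩ hgB
  -- With p² = g σ(g)⁻¹, which `σ` inverts, both σ(p) and p⁻¹ are small square roots of p⁻², hence
  -- equal. Then g = p k is a local polar decomposition, with k = p⁻¹g fixed by `σ`.
  have hσp : σ p = p⁻¹ := by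
    refine hinj hpσ hpi ?_
    simp only
    rw [← map_mul, hps, ← mul_inv_rev, hps]
    simp [hinv g]
  have hσg : σ g = (p * p)⁻¹ * g := by rw [hps]; group
  refine ⟨p⁻¹ * g, hmemK (hAB hpA hgB) ?_, ?_⟩
  · rw [map_mul, map_inv, hσp, hσg]; group
  · rw [hσg]; group

/-- A matrix coefficient of a finite-dimensional representation of a connected topological group
that vanishes near the identity vanishes identically. -/
theorem matrixCoeff_eq_zero_of_eventually {𝕜 G M : Type*} [Field 𝕜] [Group G] [TopologicalSpace G]
    [IsTopologicalGroup G] [ConnectedSpace G] [AddCommGroup M] [Module 𝕜 M] [FiniteDimensional 𝕜 M]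
    (π : Representation 𝕜 G M) (v : M) (l : M →ₗ[𝕜] 𝕜) (h : ∀ᶠ g in 𝓝 (1 : G), l (π g v) = 0)
    (g : G) : l (π g v) = 0 := by
  let W (U : Set G) : Submodule 𝕜 M := Submodule.span 𝕜 ((fun g => π g v) '' U)
  have hWmono {U V : Set G} (hUV : U ⊆ V) : W U ≤ W V := Submodule.span_mono (image_mono hUV)
  -- a neighbourhood whose span has minimal dimension
  obtain ⟨U₀, hU₀, hmin⟩ : ∃ U₀ ∈ 𝓝 (1 : G), ∀ U ∈ 𝓝 (1 : G),
      Module.finrank 𝕜 (W U₀) ≤ Module.finrank 𝕜 (W U) := by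
    obtain ⟨U₀, hU₀, hmin⟩ := exists_minimalFor_of_wellFoundedLT (· ∈ 𝓝 (1 : G))
      (fun U => Module.finrank 𝕜 (W U)) ⟨_, univ_mem⟩
    exact ⟨U₀, hU₀, fun U hU => (le_total _ _).elim id fun h => hmin hU h⟩
  have heq {U : Set G} (hU : U ∈ 𝓝 1) (hUU : U ⊆ U₀) : W U = W U₀ :=
    Submodule.eq_of_le_of_finrank_le (hWmono hUU) (hmin U hU)
  have hprod : ∀ᶠ q : G × G in 𝓝 1 ×ˢ 𝓝 1, q.1 * q.2 ∈ U₀ := by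
    rw [← nhds_prod_eq]
    exact continuous_mul.continuousAt.preimage_mem_nhds (by simpa using hU₀)
  obtain ⟨A, hA, B, hB, hAB⟩ := eventually_prod_iff.1 hprod
  -- By minimality a smaller neighbourhood spans the same space, and there is room to multiply it by
  -- `u` without leaving `U₀`. The stabiliser is therefore an open subgroup, hence everything.
  have hstab {u : G} (hu : A u) {x : M} (hx : x ∈ W U₀) : π u x ∈ W U₀ := by
    have hBU : {b | B b ∧ b ∈ U₀} ∈ 𝓝 (1 : G) := hB.and hU₀
    rw [← heq hBU fun b hb => hb.2] at hx
    have : (W {b | B b ∧ b ∈ U₀}).map (π u) ≤ W U₀ := by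
      rw [Submodule.map_span_le]
      rintro _ ⟨b, hb, rfl⟩
      exact Submodule.subset_span ⟨u * b, hAB hu hb.1, by simp⟩
    exact this (Submodule.mem_map_of_mem hx)
  let S : Subgroup G :=
    { carrier := {u | (∀ x ∈ W U₀, π u x ∈ W U₀) ∧ ∀ x ∈ W U₀, π u⁻¹ x ∈ W U₀}
      one_mem' := by simp
      mul_mem' := fun {a b} ha hb => by
        refine ⟨fun x hx => ?_, fun x hx => ?_⟩
        · rw [map_mul]; exact ha.1 _ (hb.1 _ hx)
        · rw [mul_inv_rev, map_mul]; exact hb.2 _ (ha.2 _ hx)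
      inv_mem' := fun {a} ha => ⟨ha.2, by simpa using ha.1⟩ }
  have hS : (S : Set G) ∈ 𝓝 (1 : G) := by
    have hinv1 : Tendsto (fun x : G => x⁻¹) (𝓝 1) (𝓝 1) := by
      simpa using (continuous_inv (G := G)).tendsto 1
    filter_upwards [hA, hinv1.eventually hA] with u hu hu'
    exact ⟨fun x hx => hstab hu hx, fun x hx => hstab hu' hx⟩
  have hSo : IsOpen (S : Set G) := S.isOpen_of_mem_nhds hS
  have htop : (S : Set G) = univ :=
    IsClopen.eq_univ ⟨S.isClosed_of_isOpen hSo, hSo⟩ ⟨1, S.one_mem⟩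
  have hg : g ∈ (S : Set G) := htop ▸ mem_univ g
  have hv : v ∈ W U₀ := Submodule.subset_span ⟨1, mem_of_mem_nhds hU₀, by simp⟩
  have hl : W U₀ ≤ LinearMap.ker l := by
    rw [← heq (inter_mem hU₀ h) inter_subset_left, Submodule.span_le]
    rintro _ ⟨u, hu, rfl⟩
    exact hu.2
  exact hl (hg.1 v hv)

/-- Commuting endomorphisms of a nonzero finite-dimensional space over an algebraically closed field
have a common eigenvector. -/
theorem exists_common_eigenvector {𝕜 ι M : Type*} [Field 𝕜] [IsAlgClosed 𝕜] [AddCommGroup M]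
    [Module 𝕜 M] (T : ι → Module.End 𝕜 M) (U : Submodule 𝕜 M) [FiniteDimensional 𝕜 U] (hU : U ≠ ⊥)
    (hT : ∀ i, ∀ v ∈ U, T i v ∈ U) (hcomm : ∀ i j, ∀ v ∈ U, T i (T j v) = T j (T i v)) :
    ∃ v ∈ U, v ≠ 0 ∧ ∀ i, ∃ c : 𝕜, T i v = c • v := by
  obtain ⟨W, ⟨hWU, hW, hTW⟩, hmin⟩ := exists_minimalFor_of_wellFoundedLT
    (fun W : Submodule 𝕜 M => W ≤ U ∧ W ≠ ⊥ ∧ ∀ i, ∀ v ∈ W, T i v ∈ W)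
    (fun W => Module.finrank 𝕜 W) ⟨U, le_rfl, hU, hT⟩
  obtain ⟨v, hv, hv0⟩ := Submodule.exists_mem_ne_zero_of_ne_bot hW
  refine ⟨v, hWU hv, hv0, fun i => ?_⟩
  have : FiniteDimensional 𝕜 W := Submodule.finiteDimensional_of_le hWU
  have : Nontrivial W := Submodule.nontrivial_iff_ne_bot.2 hW
  obtain ⟨c, hc⟩ := Module.End.exists_eigenvalue ((T i).restrict (hTW i))
  obtain ⟨w, hw⟩ := hc.exists_hasEigenvector
  have hw1 : T i w = c • (w : M) := by simpa using congrArg Subtype.val hw.apply_eq_smul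
  have hw2 : (w : M) ≠ 0 := by simpa using hw.2
  -- An eigenspace of one operator is stable under the others by commutativity, so minimality of `W`
  -- forces it to be all of `W`: every operator is scalar there.
  let W' : Submodule 𝕜 M := W ⊓ LinearMap.ker (T i - c • LinearMap.id)
  have hmem {x : M} : x ∈ W' ↔ x ∈ W ∧ T i x = c • x := by
    simp [W', sub_eq_zero]
  have hW' : W' = W := by
    refine Submodule.eq_of_le_of_finrank_le inf_le_left (hmin ⟨inf_le_left.trans hWU, ?_, ?_⟩
      (Submodule.finrank_mono inf_le_left))
    · exact fun h => hw2 ((Submodule.eq_bot_iff _).1 h w (hmem.2 ⟨w.2, hw1⟩))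
    · intro j x hx
      rw [hmem] at hx ⊢
      exact ⟨hTW j x hx.1, by rw [hcomm i j x (hWU hx.1), hx.2, map_smul]⟩
  exact ⟨c, (hmem.1 (hW' ▸ hv)).2⟩

end LieLocal

end

noncomputable section

set_option linter.unusedSectionVars false

open Filter Topology

namespace CompactSymmetric

/-! ### Haar measure, convolution and orthogonality of spherical functions -/

section

section HaarProb

variable (G : Type*) [Group G] [TopologicalSpace G] [IsTopologicalGroup G] [CompactSpace G]
  [MeasurableSpace G] [BorelSpace G]

instance : (haarProb G).IsHaarMeasure := by unfold haarProb; infer_instance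

instance : IsProbabilityMeasure (haarProb G) := ⟨by
  simpa [haarProb] using Measure.haarMeasure_self (K₀ := (⊤ : TopologicalSpace.PositiveCompacts G))⟩

variable {G} in
theorem eq_haarProb_of_isMulLeftInvariant (ν : Measure G) [IsProbabilityMeasure ν]
    [ν.IsMulLeftInvariant] : ν = haarProb G := by
  have h := Measure.isMulInvariant_eq_smul_of_compactSpace ν (haarProb G)
  have h1 := congrArg (fun m => m Set.univ) h
  simp only [measure_univ, Measure.smul_apply] at h1
  rw [h]
  have : Measure.haarScalarFactor ν (haarProb G) = 1 := by
    have h2 : ((Measure.haarScalarFactor ν (haarProb G) : NNReal) : ENNReal) = 1 := by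
      simpa [ENNReal.smul_def] using h1.symm
    exact_mod_cast h2
  rw [this, one_smul]

instance : (haarProb G).IsMulRightInvariant := ⟨fun g => by
  have : IsProbabilityMeasure ((haarProb G).map (· * g)) :=
    Measure.isProbabilityMeasure_map (by fun_prop)
  exact eq_haarProb_of_isMulLeftInvariant _⟩

instance : (haarProb G).IsInvInvariant := ⟨by
  have : IsProbabilityMeasure (haarProb G).inv :=
    Measure.isProbabilityMeasure_map (by fun_prop)
  exact eq_haarProb_of_isMulLeftInvariant _⟩

end HaarProb

variable {G : Type*} [Group G] [TopologicalSpace G] [IsTopologicalGroup G] [CompactSpace G]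
  [MeasurableSpace G] [BorelSpace G]

theorem integrable_haarProb {F : Type*} [NormedAddCommGroup F] {f : G → F} (hf : Continuous f) :
    Integrable f (haarProb G) :=
  hf.integrable_of_hasCompactSupport (HasCompactSupport.of_compactSpace f)

/-- Left translation of functions on a group. -/
def lt (g : G) : C(G, ℂ) →ₗ[ℂ] C(G, ℂ) where
  toFun f := f.comp ⟨fun x => g⁻¹ * x, by fun_prop⟩
  map_add' _ _ := rfl
  map_smul' _ _ := rfl

@[simp]
theorem lt_apply (g : G) (f : C(G, ℂ)) (x : G) : lt g f x = f (g⁻¹ * x) := rfl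

theorem lt_mul (g h : G) (f : C(G, ℂ)) : lt (g * h) f = lt g (lt h f) := by
  ext x; simp [mul_assoc]

theorem continuous_lt (f : C(G, ℂ)) : Continuous fun g => lt g f :=
  (ContinuousMap.curry ⟨fun p : G × G => f (p.1⁻¹ * p.2), by fun_prop⟩).continuous

/-- Convolution of continuous functions on a compact group. -/
def conv (f h : C(G, ℂ)) : C(G, ℂ) := ∫ y, f y • lt y h ∂haarProb G

theorem continuous_smul_lt (f h : C(G, ℂ)) : Continuous fun y => f y • lt y h :=
  f.continuous.smul (continuous_lt h)

theorem conv_apply (f h : C(G, ℂ)) (x : G) :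
    conv f h x = ∫ y, f y * h (y⁻¹ * x) ∂haarProb G := by
  rw [conv, ContinuousMap.integral_apply (integrable_haarProb (continuous_smul_lt f h))]
  rfl

/-- Convolution is a Bochner integral of multiples of translates, taken in `C(G, ℂ)`; a
finite-dimensional space is closed and contains it. -/
theorem conv_mem {V : Submodule ℂ C(G, ℂ)} [FiniteDimensional ℂ V] (hV : ∀ g, ∀ h ∈ V, lt g h ∈ V)
    (f : C(G, ℂ)) {h : C(G, ℂ)} (hh : h ∈ V) : conv f h ∈ V := by
  have hc : IsClosed (V : Set C(G, ℂ)) := V.closed_of_finiteDimensional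
  have hconv : Convex ℝ (V : Set C(G, ℂ)) := (V.restrictScalars ℝ).convex
  exact hconv.integral_mem hc (Eventually.of_forall fun y => V.smul_mem _ (hV y h hh))
    (integrable_haarProb (continuous_smul_lt f h))

theorem conv_assoc (f g h : C(G, ℂ)) : conv (conv f g) h = conv f (conv g h) := by
  ext x
  simp only [conv_apply, ← integral_mul_const, ← integral_const_mul]
  rw [integral_integral_swap_of_hasCompactSupport (by fun_prop) (HasCompactSupport.of_compactSpace _)]
  refine integral_congr_ae (Eventually.of_forall fun y => ?_)
  simp only
  rw [← integral_mul_left_eq_self _ y]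
  simp [mul_assoc]

/-- Convolution as a linear map in its second argument. -/
def convL (f : C(G, ℂ)) : C(G, ℂ) →ₗ[ℂ] C(G, ℂ) where
  toFun := conv f
  map_add' g h := by
    ext x
    simp only [conv_apply, ContinuousMap.add_apply, mul_add]
    exact integral_add (integrable_haarProb (by fun_prop)) (integrable_haarProb (by fun_prop))
  map_smul' c h := by
    ext x
    simp only [conv_apply, ContinuousMap.smul_apply, RingHom.id_apply, smul_eq_mul,
      ← integral_const_mul]
    congr 1
    funext y
    ring

@[simp]
theorem convL_apply (f h : C(G, ℂ)) : convL f h = conv f h := rfl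

/-- Convolution as a linear map in its first argument. -/
def convR (h : C(G, ℂ)) : C(G, ℂ) →ₗ[ℂ] C(G, ℂ) where
  toFun f := conv f h
  map_add' f g := by
    ext x
    simp only [conv_apply, ContinuousMap.add_apply, add_mul]
    exact integral_add (integrable_haarProb (by fun_prop)) (integrable_haarProb (by fun_prop))
  map_smul' c f := by
    ext x
    simp only [conv_apply, ContinuousMap.smul_apply, RingHom.id_apply, smul_eq_mul,
      ← integral_const_mul]
    congr 1
    funext y
    ring

@[simp]
theorem convR_apply (f h : C(G, ℂ)) : convR h f = conv f h := rfl

theorem lt_conv (g : G) (f h : C(G, ℂ)) : lt g (conv f h) = conv (lt g f) h := by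
  ext x
  simp only [lt_apply, conv_apply]
  rw [← integral_mul_left_eq_self _ g⁻¹]
  simp [mul_assoc]

/-- Bi-invariance of a function under a subgroup. -/
def BiInv (K : Subgroup G) (f : C(G, ℂ)) : Prop :=
  ∀ k ∈ K, ∀ x, f (k * x) = f x ∧ f (x * k) = f x

/-- Spherical functions, as functions on the group. -/
def IsSph (K : Subgroup G) [CompactSpace K] (f : C(G, ℂ)) : Prop :=
  f 1 = 1 ∧ ∀ x y : G, ∫ k : K, f (x * k * y) ∂haarProb K = f x * f y

variable {K : Subgroup G} [CompactSpace K] {φ ψ : C(G, ℂ)}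

theorem IsSph.biInv (hφ : IsSph K φ) : BiInv K φ := by
  intro k hk x
  constructor
  · have h1 := hφ.2 1 (k * x)
    have h2 := hφ.2 1 x
    have h3 := integral_mul_right_eq_self (μ := haarProb K) (fun k' : K => φ (1 * k' * x)) ⟨k, hk⟩
    simp only [hφ.1, one_mul, Subgroup.coe_mul, mul_assoc] at h1 h2 h3
    rw [← h1, h3, h2]
  · have h1 := hφ.2 (x * k) 1
    have h2 := hφ.2 x 1
    have h3 := integral_mul_left_eq_self (μ := haarProb K) (fun k' : K => φ (x * k' * 1)) ⟨k, hk⟩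
    simp only [hφ.1, mul_one, Subgroup.coe_mul, ← mul_assoc] at h1 h2 h3
    rw [← h1, h3, h2]

/-- Averaging over a subgroup does not change the pairing with an invariant function. -/
theorem integral_mul_integral_eq {f H : G → ℂ} (hf : Continuous f) (hH : Continuous H)
    (hK : ∀ k ∈ K, ∀ x, f (x * k) = f x) :
    ∫ y, f y * ∫ k : K, H (y * k) ∂haarProb K ∂haarProb G = ∫ y, f y * H y ∂haarProb G := by
  simp only [← integral_const_mul]
  rw [integral_integral_swap_of_hasCompactSupport (by fun_prop) (HasCompactSupport.of_compactSpace _)]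
  have h (k : K) : ∫ y, f y * H (y * k) ∂haarProb G = ∫ y, f y * H y ∂haarProb G := by
    rw [← integral_mul_right_eq_self (μ := haarProb G) (fun y => f y * H y) (k : G)]
    simp [hK k k.2]
  simp [h]

/-- Invariance of `f` allows `y` to be averaged over `yK`, and the average of `φ (y * k * x)`
factors. This is the source of both the eigenfunction property and the regression identities. -/
theorem IsSph.integral_mul_comp_mul (hφ : IsSph K φ) {f : G → ℂ} (hf : Continuous f)
    (hK : ∀ k ∈ K, ∀ x, f (x * k) = f x) (x : G) :
    ∫ y, f y * φ (y * x) ∂haarProb G = (∫ y, f y * φ y ∂haarProb G) * φ x := by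
  rw [← integral_mul_integral_eq hf (H := fun y => φ (y * x)) (by fun_prop) hK,
    ← integral_mul_const]
  simp only [hφ.2]
  simp only [mul_assoc]

/-- The `L²` inner product. -/
def ip (f h : C(G, ℂ)) : ℂ := ∫ y, f y * conj (h y) ∂haarProb G

theorem ip_conj (f h : C(G, ℂ)) : conj (ip f h) = ip h f := by
  rw [ip, ip, ← integral_conj]
  simp [mul_comm]

/-- The squared `L²` norm. -/
def nsq (f : C(G, ℂ)) : ℝ := ∫ y, ‖f y‖ ^ 2 ∂haarProb G

theorem ip_self (f : C(G, ℂ)) : ip f f = nsq f := by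
  rw [ip, nsq, ← integral_complex_ofReal]
  simp [Complex.mul_conj, Complex.normSq_eq_norm_sq]

theorem nsq_pos {f : C(G, ℂ)} (hf : f ≠ 0) : 0 < nsq f := by
  obtain ⟨x, hx⟩ := DFunLike.ne_iff.1 hf
  exact Continuous.integral_pos_of_hasCompactSupport_nonneg_nonzero (by fun_prop)
    (HasCompactSupport.of_compactSpace _) (fun x => by positivity) (x := x) (by simpa using hx)

theorem IsSph.ne_zero (hφ : IsSph K φ) : φ ≠ 0 := fun h => by simpa [h] using hφ.1

theorem IsSph.nsq_pos (hφ : IsSph K φ) : 0 < nsq φ := CompactSymmetric.nsq_pos hφ.ne_zero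

theorem IsSph.nsq_mul_apply (hφ : IsSph K φ) (x : G) :
    ∫ y, conj (φ y) * φ (y * x) ∂haarProb G = nsq φ * φ x := by
  rw [hφ.integral_mul_comp_mul (f := fun y => conj (φ y)) (by fun_prop)
    (fun k hk x => by rw [(hφ.biInv k hk x).2]), ← ip_self, ip]
  simp only [mul_comm]

/-- `nsq φ * φ x` is the autocorrelation of `φ`, which is Hermitian by translation invariance of
Haar measure. -/
theorem IsSph.apply_inv (hφ : IsSph K φ) (x : G) : φ x⁻¹ = conj (φ x) := by
  have h0 : (nsq φ : ℂ) ≠ 0 := by exact_mod_cast hφ.nsq_pos.ne'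
  apply mul_left_cancel₀ h0
  rw [← hφ.nsq_mul_apply, ← Complex.conj_ofReal (nsq φ), ← map_mul, ← hφ.nsq_mul_apply,
    ← integral_conj, ← integral_mul_right_eq_self _ x]
  simp [mul_comm]

/-- Spherical functions are eigenfunctions of convolution with bi-invariant functions. -/
theorem IsSph.conv_eq (hφ : IsSph K φ) {f : C(G, ℂ)} (hf : BiInv K f) :
    conv f φ = ip f φ • φ := by
  ext x
  have h := hφ.integral_mul_comp_mul (f := fun y => f y⁻¹) (by fun_prop)
    (fun k hk x => by rw [mul_inv_rev]; exact (hf k⁻¹ (K.inv_mem hk) _).1) x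
  rw [conv_apply, ContinuousMap.smul_apply, smul_eq_mul, ip,
    ← integral_inv_eq_self _ (haarProb G), ← integral_inv_eq_self (fun y => f y * conj (φ y))]
  simpa [hφ.apply_inv] using h

theorem IsSph.conv_self (hφ : IsSph K φ) : conv φ φ = (nsq φ : ℂ) • φ := by
  rw [hφ.conv_eq hφ.biInv, ip_self]

/-- Distinct spherical functions are orthogonal. -/
theorem IsSph.ip_eq_zero (hφ : IsSph K φ) (hψ : IsSph K ψ) (h : φ ≠ ψ) : ip φ ψ = 0 := by
  by_contra h0
  apply h
  have e1 := hψ.conv_eq hφ.biInv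
  have e2 := hφ.conv_eq hψ.biInv
  -- The two convolutions are adjoint to each other, while one is a multiple of `ψ` and the other of
  -- `φ`; a nonzero inner product would force `φ = ψ`.
  have e3 (x : G) : conv ψ φ x = conj (conv φ ψ x⁻¹) := by
    rw [conv_apply, conv_apply, ← integral_conj, ← integral_mul_left_eq_self _ x]
    simp [← hφ.apply_inv, ← hψ.apply_inv, mul_comm, mul_assoc]
  ext x
  have e4 := e3 x
  rw [e1, e2, ContinuousMap.smul_apply, ContinuousMap.smul_apply, smul_eq_mul, smul_eq_mul, map_mul,
    ip_conj, ← hψ.apply_inv, inv_inv] at e4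
  refine mul_left_cancel₀ (fun h => h0 ?_) e4
  rw [← ip_conj, h, map_zero]

theorem IsSph.conv_eq_zero (hφ : IsSph K φ) (hψ : IsSph K ψ) (h : φ ≠ ψ) : conv φ ψ = 0 := by
  rw [hψ.conv_eq hφ.biInv, hφ.ip_eq_zero hψ h, zero_smul]

end

/-! ### The dimension of the space of translates -/

section

variable {G : Type*} [Group G] [TopologicalSpace G] [IsTopologicalGroup G] [CompactSpace G]
  [MeasurableSpace G] [BorelSpace G] {K : Subgroup G} [CompactSpace K] {φ ψ : C(G, ℂ)}

/-- The space spanned by the left translates of a function. -/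
def transl (f : C(G, ℂ)) : Submodule ℂ C(G, ℂ) := Submodule.span ℂ (Set.range fun g => lt g f)

theorem lt_mem_transl (g : G) {f h : C(G, ℂ)} (hh : h ∈ transl f) : lt g h ∈ transl f := by
  have : (transl f).map (lt g) ≤ transl f := by
    rw [transl, Submodule.map_span_le]
    rintro _ ⟨g', rfl⟩
    exact Submodule.subset_span ⟨g * g', lt_mul g g' f⟩
  exact this (Submodule.mem_map_of_mem hh)

theorem self_mem_transl (f : C(G, ℂ)) : f ∈ transl f :=
  Submodule.subset_span ⟨1, by ext x; simp⟩

theorem IsSph.conv_of_mem_transl (hφ : IsSph K φ) {h : C(G, ℂ)} (hh : h ∈ transl φ) :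
    conv h φ = (nsq φ : ℂ) • h := by
  have : transl φ ≤ LinearMap.ker (convR φ - (nsq φ : ℂ) • LinearMap.id) := by
    rw [transl, Submodule.span_le]
    rintro _ ⟨g, rfl⟩
    simp [← lt_conv, hφ.conv_self]
  simpa [sub_eq_zero] using this hh

theorem nsq_lt (x : G) (φ : C(G, ℂ)) : nsq (lt x φ) = nsq φ := by
  simp only [nsq, lt_apply]
  exact integral_mul_left_eq_self (fun y => ‖φ y‖ ^ 2) x⁻¹

theorem inner_toLp_eq_ip (f h : C(G, ℂ)) :
    inner ℂ (ContinuousMap.toLp 2 (haarProb G) ℂ f) (ContinuousMap.toLp 2 (haarProb G) ℂ h) =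
      ip h f := by
  rw [ContinuousMap.inner_toLp]
  simp [ip]

theorem norm_toLp_sq (f : C(G, ℂ)) :
    ‖ContinuousMap.toLp (E := ℂ) 2 (haarProb G) ℂ f‖ ^ 2 = nsq f := by
  rw [← inner_self_eq_norm_sq (𝕜 := ℂ), inner_toLp_eq_ip, ip_self]
  simp

/-- Up to the factor `nsq φ`, `φ` is a reproducing kernel for its translates. Bessel's inequality
for `lt x φ` against an orthonormal basis of `W`, integrated over `x`, bounds the dimension without
assuming that `transl φ` is finite-dimensional. -/
theorem IsSph.finrank_mul_nsq_le (hφ : IsSph K φ) {W : Submodule ℂ C(G, ℂ)} [FiniteDimensional ℂ W]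
    (hW : W ≤ transl φ) : Module.finrank ℂ W * nsq φ ≤ 1 := by
  set e := ContinuousMap.toLp (E := ℂ) 2 (haarProb G) ℂ with he
  have hinj : Function.Injective e := ContinuousMap.toLp_injective _
  set W₂ := W.map e.toLinearMap with hW₂
  have hfin : Module.finrank ℂ W₂ = Module.finrank ℂ W :=
    (Submodule.equivMapOfInjective e.toLinearMap hinj W).finrank_eq.symm
  set b := stdOrthonormalBasis ℂ W₂ with hb
  have hu (i : Fin (Module.finrank ℂ W₂)) : ∃ u ∈ W, e u = (b i : Lp ℂ 2 (haarProb G)) :=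
    (Submodule.mem_map.1 (b i).2)
  choose u huW hu using hu
  have hon : Orthonormal ℂ fun i => e (u i) := by
    simp only [hu]
    exact b.orthonormal.comp_linearIsometry W₂.subtypeₗᵢ
  have hone (i) : ∫ x, ‖u i x‖ ^ 2 ∂haarProb G = 1 := by
    rw [← nsq, ← norm_toLp_sq, hon.1 i, one_pow]
  have h0 := hφ.nsq_pos
  have hbessel (x : G) : ∑ i, ‖u i x‖ ^ 2 * nsq φ ≤ 1 := by
    have h1 := hon.sum_inner_products_le (e (lt x φ)) (s := Finset.univ)
    have h2 : ‖e (lt x φ)‖ ^ 2 = nsq φ := by rw [he, norm_toLp_sq, nsq_lt]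
    have h3 (i) : ‖inner ℂ (e (u i)) (e (lt x φ))‖ = nsq φ * ‖u i x‖ := by
      have h4 := congrArg (fun f : C(G, ℂ) => f x) (hφ.conv_of_mem_transl (hW (huW i)))
      simp only [conv_apply, ContinuousMap.smul_apply, smul_eq_mul] at h4
      rw [he, inner_toLp_eq_ip, ← ip_conj, RCLike.norm_conj, ip]
      have h5 (y : G) : conj (lt x φ y) = φ (y⁻¹ * x) := by
        rw [lt_apply, ← hφ.apply_inv]; simp
      simp only [h5, h4, norm_mul, Complex.norm_real, Real.norm_eq_abs, abs_of_pos h0]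
    simp only [h2, h3, mul_pow] at h1
    refine le_of_mul_le_mul_right ?_ h0
    rw [one_mul, Finset.sum_mul]
    refine le_trans (le_of_eq (Finset.sum_congr rfl fun i _ => ?_)) h1
    ring
  have hint : ∫ x, ∑ i, ‖u i x‖ ^ 2 * nsq φ ∂haarProb G ≤ ∫ _, 1 ∂haarProb G :=
    integral_mono (integrable_haarProb (by fun_prop)) (integrable_const _) hbessel
  rw [integral_finsetSum _ fun i _ => integrable_haarProb (by fun_prop)] at hint
  simp only [integral_mul_const, hone] at hint
  simpa [hfin] using hint

theorem IsSph.finiteDimensional_transl (hφ : IsSph K φ) : FiniteDimensional ℂ (transl φ) := by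
  have h0 := hφ.nsq_pos
  have hr : Module.rank ℂ (transl φ) ≤ (⌊(nsq φ)⁻¹⌋₊ : ℕ) := by
    refine rank_le fun s hs => ?_
    have h1 : LinearIndependent ℂ fun i : s => ((i : transl φ) : C(G, ℂ)) :=
      hs.map' (transl φ).subtype (Submodule.ker_subtype _)
    set W := Submodule.span ℂ (Set.range fun i : s => ((i : transl φ) : C(G, ℂ))) with hW
    have h2 : Module.finrank ℂ W = s.card := by
      rw [hW, finrank_span_eq_card h1, Fintype.card_coe]
    have : FiniteDimensional ℂ W := FiniteDimensional.span_of_finite ℂ (Set.finite_range _)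
    have h3 := hφ.finrank_mul_nsq_le (W := W) (by
      rw [hW, Submodule.span_le]
      rintro _ ⟨i, rfl⟩
      exact i.1.2)
    rw [h2] at h3
    exact Nat.le_floor (by rwa [← one_div, le_div_iff₀ h0])
  exact Module.rank_lt_aleph0_iff.1 (hr.trans_lt (Cardinal.natCast_lt_aleph0))

/-- The dimension of the space of translates of a spherical function is the inverse of its squared
norm. -/
theorem IsSph.finrank_mul_nsq (hφ : IsSph K φ) : (Module.finrank ℂ (transl φ) : ℝ) * nsq φ = 1 := by
  have := hφ.finiteDimensional_transl
  set n := Module.finrank ℂ (transl φ)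
  let b : Module.Basis (Fin n) ℂ (transl φ) := Module.finBasis ℂ (transl φ)
  let v (y : G) : transl φ := ⟨lt y φ, Submodule.subset_span ⟨y, rfl⟩⟩
  let β (i : Fin n) (y : G) : ℂ := b.coord i (v y)
  have hv : Continuous v := (continuous_lt φ).subtype_mk _
  have hβ (i) : Continuous (β i) := (b.coord i).continuous_of_finiteDimensional.comp hv
  have hsum (y : G) : ∑ i, β i y • (b i : C(G, ℂ)) = lt y φ := by
    have := congrArg (transl φ).subtype (b.sum_repr (v y))
    rwa [map_sum] at this
  have hsum' (y x : G) : ∑ i, β i y * (b i : C(G, ℂ)) x = φ (y⁻¹ * x) := by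
    have := congrArg (fun f : C(G, ℂ) => f x) (hsum y)
    simpa [ContinuousMap.sum_apply] using this
  -- The trace of `h ↦ conv h φ` on `transl φ` is computed twice: it is `n * nsq φ` because the
  -- operator is scalar, and it is the integral of `φ (y⁻¹ * y) = 1`.
  have hconv (j : Fin n) : ∑ i, (∫ y, (b j : C(G, ℂ)) y * β i y ∂haarProb G) • b i =
      (nsq φ : ℂ) • b j := by
    apply Subtype.ext
    have h1 := hφ.conv_of_mem_transl (b j).2
    rw [Submodule.coe_smul, ← h1]
    ext x
    rw [conv_apply]
    simp only [← hsum', Finset.mul_sum]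
    rw [integral_finsetSum _ fun i _ => integrable_haarProb (by fun_prop)]
    simp [ContinuousMap.sum_apply, ← integral_mul_const, mul_assoc]
  have hdiag (j : Fin n) : ∫ y, (b j : C(G, ℂ)) y * β j y ∂haarProb G = nsq φ := by
    have := congrArg (fun w => b.repr w j) (hconv j)
    simpa [Finsupp.single_apply] using this
  have h1 : ∑ j : Fin n, ∫ y, (b j : C(G, ℂ)) y * β j y ∂haarProb G = 1 := by
    rw [← integral_finsetSum _ fun i _ => integrable_haarProb (by fun_prop)]
    have (y : G) : ∑ j, (b j : C(G, ℂ)) y * β j y = 1 := by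
      have := hsum' y y
      rw [inv_mul_cancel, hφ.1] at this
      simpa [mul_comm] using this
    simp [this]
  simp only [hdiag, Finset.sum_const, Finset.card_univ, Fintype.card_fin, nsmul_eq_mul] at h1
  exact_mod_cast h1

end

/-! ### Functions of finite type, and Gelfand's trick -/

section

variable {G : Type*} [Group G] [TopologicalSpace G] [IsTopologicalGroup G] [CompactSpace G]
  [MeasurableSpace G] [BorelSpace G] {K : Subgroup G} [CompactSpace K] {φ ψ f h : C(G, ℂ)}

/-- A function lies in a finite-dimensional left invariant space. -/
def LFin (f : C(G, ℂ)) : Prop :=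
  ∃ V : Submodule ℂ C(G, ℂ), FiniteDimensional ℂ V ∧ (∀ g, ∀ h ∈ V, lt g h ∈ V) ∧ f ∈ V

theorem IsSph.lFin (hφ : IsSph K φ) : LFin φ :=
  ⟨transl φ, hφ.finiteDimensional_transl, fun g _ hh => lt_mem_transl g hh, self_mem_transl φ⟩

theorem LFin.mul (hf : LFin f) (hh : LFin h) : LFin (f * h) := by
  obtain ⟨V, hV, hVl, hfV⟩ := hf
  obtain ⟨W, hW, hWl, hhW⟩ := hh
  refine ⟨V * W, ?_, fun g p hp => ?_, Submodule.mul_mem_mul hfV hhW⟩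
  · exact Module.Finite.iff_fg.2 ((Module.Finite.iff_fg.1 hV).mul (Module.Finite.iff_fg.1 hW))
  · refine Submodule.mul_induction_on hp (fun a ha b hb => ?_) fun a b ha hb => ?_
    · have : lt g (a * b) = lt g a * lt g b := rfl
      rw [this]
      exact Submodule.mul_mem_mul (hVl g a ha) (hWl g b hb)
    · rw [map_add]; exact Submodule.add_mem _ ha hb

theorem LFin.add (hf : LFin f) (hh : LFin h) : LFin (f + h) := by
  obtain ⟨V, hV, hVl, hfV⟩ := hf
  obtain ⟨W, hW, hWl, hhW⟩ := hh
  refine ⟨V ⊔ W, inferInstance, fun g p hp => ?_,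
    Submodule.add_mem_sup hfV hhW⟩
  obtain ⟨a, ha, b, hb, rfl⟩ := Submodule.mem_sup.1 hp
  rw [map_add]
  exact Submodule.add_mem_sup (hVl g a ha) (hWl g b hb)

theorem LFin.smul (c : ℂ) (hf : LFin f) : LFin (c • f) := by
  obtain ⟨V, hV, hVl, hfV⟩ := hf
  exact ⟨V, hV, hVl, V.smul_mem c hfV⟩

theorem LFin.conv (f : C(G, ℂ)) (hh : LFin h) : LFin (conv f h) := by
  obtain ⟨V, hV, hVl, hhV⟩ := hh
  exact ⟨V, hV, hVl, conv_mem hVl f hhV⟩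

/-- The image of an invariant space stays invariant once `T` intertwines translations up to
relabelling the group element. Semilinearity covers complex conjugation, relabelling covers
composition with `σ`. -/
theorem LFin.map (hf : LFin f) {s : ℂ →+* ℂ} [RingHomSurjective s] (T : C(G, ℂ) →ₛₗ[s] C(G, ℂ))
    (hT : ∀ g, ∃ g', ∀ f, lt g (T f) = T (lt g' f)) : LFin (T f) := by
  obtain ⟨V, hV, hVl, hfV⟩ := hf
  refine ⟨V.map T, ?_, ?_, Submodule.mem_map_of_mem hfV⟩
  · exact Module.Finite.iff_fg.2 ((Module.Finite.iff_fg.1 hV).map T)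
  · rintro g _ ⟨p, hp, rfl⟩
    obtain ⟨g', hg'⟩ := hT g
    rw [hg']
    exact Submodule.mem_map_of_mem (hVl g' p hp)

theorem LFin.star (hf : LFin f) : LFin (star f) :=
  hf.map (starLinearEquiv ℂ : C(G, ℂ) ≃ₗ⋆[ℂ] C(G, ℂ)).toLinearMap fun g => ⟨g, fun _ => rfl⟩

/-- Composition with a continuous endomorphism. -/
def compHom (σ : G →* G) (hσ : Continuous σ) : C(G, ℂ) →ₗ[ℂ] C(G, ℂ) where
  toFun f := f.comp ⟨σ, hσ⟩
  map_add' _ _ := rfl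
  map_smul' _ _ := rfl

@[simp]
theorem compHom_apply (σ : G →* G) (hσ : Continuous σ) (f : C(G, ℂ)) (x : G) :
    compHom σ hσ f x = f (σ x) := rfl

theorem LFin.compHom {σ : G →* G} (hσ : Continuous σ) (hf : LFin f) :
    LFin (compHom σ hσ f) :=
  hf.map _ fun g => ⟨σ g, fun f => by ext x; simp⟩

/-- Right translation of functions, averaged over a subgroup. -/
def avg (K : Subgroup G) [CompactSpace K] (y : G) (f : C(G, ℂ)) : C(G, ℂ) :=
  ∫ k : K, f.comp ⟨fun x => x * k * y, by fun_prop⟩ ∂haarProb K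

theorem avg_apply (y : G) (f : C(G, ℂ)) (x : G) :
    avg K y f x = ∫ k : K, f (x * k * y) ∂haarProb K := by
  have hc : Continuous fun k : K => f.comp ⟨fun x => x * k * y, by fun_prop⟩ :=
    (ContinuousMap.curry ⟨fun p : K × G => f (p.2 * p.1 * y), by fun_prop⟩).continuous
  rw [avg, ContinuousMap.integral_apply (integrable_haarProb hc)]
  rfl

/-- `avg` as a linear map. -/
def avgL (K : Subgroup G) [CompactSpace K] (y : G) : C(G, ℂ) →ₗ[ℂ] C(G, ℂ) where
  toFun f := avg K y f
  map_add' f h := by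
    ext x
    simp only [avg_apply, ContinuousMap.add_apply]
    exact integral_add (integrable_haarProb (by fun_prop)) (integrable_haarProb (by fun_prop))
  map_smul' c f := by
    ext x
    simp only [avg_apply, ContinuousMap.smul_apply, integral_smul, RingHom.id_apply]

theorem LFin.avg (y : G) (hf : LFin f) : LFin (avg K y f) :=
  hf.map (avgL K y) fun g => ⟨g, fun f => by
    ext x
    simp [avgL, avg_apply, mul_assoc]⟩

theorem conv_avg (y : G) (f h : C(G, ℂ)) : conv f (avg K y h) = avg K y (conv f h) := by
  ext x
  simp only [conv_apply, avg_apply, ← integral_const_mul]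
  rw [integral_integral_swap_of_hasCompactSupport (by fun_prop) (HasCompactSupport.of_compactSpace _)]
  simp only [mul_assoc]

theorem BiInv.add (hf : BiInv K f) (hh : BiInv K h) : BiInv K (f + h) := fun k hk x => by
  simp [(hf k hk x).1, (hf k hk x).2, (hh k hk x).1, (hh k hk x).2]

theorem BiInv.smul (c : ℂ) (hf : BiInv K f) : BiInv K (c • f) := fun k hk x => by
  simp [(hf k hk x).1, (hf k hk x).2]

theorem BiInv.mul (hf : BiInv K f) (hh : BiInv K h) : BiInv K (f * h) := fun k hk x => by
  simp [(hf k hk x).1, (hf k hk x).2, (hh k hk x).1, (hh k hk x).2]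

theorem BiInv.conv (hf : BiInv K f) (hh : BiInv K h) : BiInv K (conv f h) := fun k hk x => by
  constructor
  · simp only [conv_apply]
    rw [← integral_mul_left_eq_self _ k]
    simp [mul_assoc, (hf k hk _).1]
  · simp only [conv_apply, ← mul_assoc, (hh k hk _).2]

theorem BiInv.avg (y : G) (hf : BiInv K f) : BiInv K (avg K y f) := fun k hk x => by
  simp only [avg_apply]
  constructor
  · simp only [mul_assoc, (hf k hk _).1]
  · rw [← integral_mul_left_eq_self (fun k' : K => f (x * k' * y)) ⟨k, hk⟩]
    simp only [Subgroup.coe_mul, mul_assoc]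

theorem BiInv.compHom {σ : G →* G} (hσ : Continuous σ) (hK : ∀ k ∈ K, σ k = k) (hf : BiInv K f) :
    BiInv K (compHom σ hσ f) := fun k hk x => by
  simp [hK k hk, (hf k hk _).1, (hf k hk _).2]

/-- The left translation representation on an invariant space. -/
def ltRep (V : Submodule ℂ C(G, ℂ)) (hV : ∀ g, ∀ h ∈ V, lt g h ∈ V) : Representation ℂ G V where
  toFun g := (lt g).restrict (hV g)
  map_one' := by ext p x; simp
  map_mul' g h := by ext p x; simp [mul_assoc]

/-- On bi-invariant functions of finite type, the involution acts as inversion. -/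
theorem LFin.apply_map_eq [ConnectedSpace G] {σ : G →* G} (hf : LFin f) (hb : BiInv K f)
    (hloc : ∀ᶠ g in 𝓝 (1 : G), ∃ k ∈ K, σ g = k * g⁻¹ * k) (g : G) : f (σ g) = f g⁻¹ := by
  obtain ⟨V, hV, hVl, hfV⟩ := hf
  let ev : Module.Dual ℂ V :=
    { toFun := fun p => (p : C(G, ℂ)) 1
      map_add' := fun _ _ => rfl
      map_smul' := fun _ _ => rfl }
  let l : V × Module.Dual ℂ V →ₗ[ℂ] ℂ :=
    { toFun := fun p => p.2 ⟨f, hfV⟩ - ev p.1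
      map_add' := fun p q => by simp only [Prod.fst_add, Prod.snd_add, map_add, LinearMap.add_apply]; ring
      map_smul' := fun c p => by
        simp only [Prod.smul_fst, Prod.smul_snd, map_smul, LinearMap.smul_apply, smul_eq_mul,
          RingHom.id_apply]; ring }
  -- Placing `V` beside its dual twisted by `σ` makes f(σ g) - f(g⁻¹) a single matrix coefficient;
  -- by `hloc` and bi-invariance it vanishes near 1.
  let π : Representation ℂ G (V × Module.Dual ℂ V) :=
    (ltRep V hVl).prod ((ltRep V hVl).dual.comp σ)
  have hl (g : G) : l (π g (⟨f, hfV⟩, ev)) = f (σ g) - f g⁻¹ := by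
    change (lt (σ g)⁻¹ f) 1 - (lt g f) 1 = _
    simp
  have := LieLocal.matrixCoeff_eq_zero_of_eventually π (⟨f, hfV⟩, ev) l (by
    filter_upwards [hloc] with g ⟨k, hk, hg⟩
    rw [hl, hg, (hb k hk _).2, (hb k hk _).1, sub_self]) g
  rw [hl] at this
  exact sub_eq_zero.1 this

theorem integral_comp_involutive {σ : G →* G} (hσ : Continuous σ) (hi : Function.Involutive σ)
    (F : G → ℂ) : ∫ x, F (σ x) ∂haarProb G = ∫ x, F x ∂haarProb G := by
  have hm : MeasurePreserving σ (haarProb G) (haarProb G) :=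
    MonoidHom.measurePreserving hσ hi.surjective rfl
  let e : G ≃ₜ G := ⟨hi.toPerm, hσ, hσ⟩
  exact hm.integral_comp e.measurableEmbedding F

/-- If the involution acts as inversion on bi-invariant functions, convolution is commutative. -/
theorem conv_comm_of_forall {σ : G →* G} (hσ : Continuous σ) (hi : Function.Involutive σ)
    (hK : ∀ k ∈ K, σ k = k)
    (hs : ∀ f : C(G, ℂ), LFin f → BiInv K f → ∀ g, f (σ g) = f g⁻¹)
    (hf : LFin f) (hfb : BiInv K f) (hh : LFin h) (hhb : BiInv K h) : conv f h = conv h f := by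
  have key {f h : C(G, ℂ)} (hf : LFin f) (hfb : BiInv K f) (hh : LFin h) (hhb : BiInv K h) :
      conv (compHom σ hσ f) (compHom σ hσ h) = conv (compHom σ hσ h) (compHom σ hσ f) := by
    ext x
    have h1 : conv (compHom σ hσ f) (compHom σ hσ h) x = conv f h (σ x) := by
      rw [conv_apply, conv_apply,
        ← integral_comp_involutive hσ hi (fun y => f y * h (y⁻¹ * σ x))]
      simp
    -- Inversion reverses convolutions whereas `σ` preserves their order. The two agree on `f`, `h`
    -- and also on `conv f h`, which is again bi-invariant of finite type.
    have h2 : conv (compHom σ hσ h) (compHom σ hσ f) x = conv f h x⁻¹ := by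
      rw [conv_apply, conv_apply, ← integral_mul_left_eq_self _ x]
      simp only [compHom_apply, hs f hf hfb, hs h hh hhb]
      simp [mul_comm]
    rw [h1, h2, hs _ (hh.conv f) (hfb.conv hhb)]
  have := key (hf.compHom hσ) (hfb.compHom hσ hK) (hh.compHom hσ) (hhb.compHom hσ hK)
  have e (f : C(G, ℂ)) : compHom σ hσ (compHom σ hσ f) = f := by ext x; simp [hi x]
  rwa [e, e] at this

end

/-! ### Expansion in spherical functions -/

section

variable {G : Type*} [Group G] [TopologicalSpace G] [IsTopologicalGroup G] [CompactSpace G]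
  [MeasurableSpace G] [BorelSpace G] {K : Subgroup G} [CompactSpace K] {φ ψ f h : C(G, ℂ)}

/-- The adjoint `x ↦ conj (f x⁻¹)` of a function. -/
def adj (f : C(G, ℂ)) : C(G, ℂ) := ⟨fun x => conj (f x⁻¹), by fun_prop⟩

@[simp]
theorem adj_apply (f : C(G, ℂ)) (x : G) : adj f x = conj (f x⁻¹) := rfl

theorem BiInv.adj (hf : BiInv K f) : BiInv K (adj f) := fun k hk x => by
  simp [(hf k⁻¹ (K.inv_mem hk) _).1, (hf k⁻¹ (K.inv_mem hk) _).2]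

/-- The bi-invariant functions of finite type form a commutative convolution algebra with
involution. -/
structure IsGelfand (K : Subgroup G) : Prop where
  conv_comm : ∀ {f h : C(G, ℂ)}, LFin f → BiInv K f → LFin h → BiInv K h → conv f h = conv h f
  adj_lFin : ∀ {f : C(G, ℂ)}, LFin f → BiInv K f → LFin (adj f)

theorem isGelfand_of_eventually [ConnectedSpace G] {σ : G →* G} (hσ : Continuous σ)
    (hi : Function.Involutive σ) (hK : ∀ k ∈ K, σ k = k)
    (hloc : ∀ᶠ g in 𝓝 (1 : G), ∃ k ∈ K, σ g = k * g⁻¹ * k) : IsGelfand K where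
  conv_comm hf hfb hh hhb := conv_comm_of_forall hσ hi hK
    (fun _ hf hfb g => hf.apply_map_eq hfb hloc g) hf hfb hh hhb
  adj_lFin {f} hf hfb := by
    have : adj f = star (compHom σ hσ f) := by
      ext x
      simp [hf.apply_map_eq hfb hloc]
    rw [this]
    exact (hf.compHom hσ).star

theorem conv_adj_self_apply_inv (h : C(G, ℂ)) (x : G) :
    conv h (adj h) x⁻¹ = conj (conv h (adj h) x) := by
  rw [conv_apply, conv_apply, ← integral_conj, ← integral_mul_left_eq_self _ x⁻¹]
  simp [mul_comm]

theorem conv_adj_self_apply_one (h : C(G, ℂ)) : conv (adj h) h 1 = nsq h := by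
  have h1 := ip_self h
  rw [ip, ← integral_inv_eq_self] at h1
  rw [conv_apply, ← h1]
  simp [mul_comm]

/-- A common eigenvector of the convolution operators is a multiple of a spherical function. -/
theorem IsGelfand.exists_isSph_of_eigenvector (hG : IsGelfand K) (hf : LFin h) (hb : BiInv K h)
    (h0 : h ≠ 0) (heig : ∀ f : C(G, ℂ), LFin f → BiInv K f → ∃ c : ℂ, conv f h = c • h) :
    ∃ φ, IsSph K φ ∧ ∃ c : ℂ, c ≠ 0 ∧ h = c • φ := by
  have ha := hG.adj_lFin hf hb
  obtain ⟨c, hc⟩ := heig _ ha hb.adj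
  have hn : (nsq h : ℂ) ≠ 0 := by exact_mod_cast (nsq_pos h0).ne'
  -- Evaluating the eigenvalue equation for `adj h` at 1 shows that both `c` and `h 1` are nonzero,
  -- so `h` can be normalised.
  have hc1 : c * h 1 = nsq h := by rw [← conv_adj_self_apply_one, hc]; simp
  have hc0 : c ≠ 0 := fun h' => hn (by rw [← hc1, h', zero_mul])
  have h10 : h 1 ≠ 0 := fun h' => hn (by rw [← hc1, h', mul_zero])
  have hcc0 : conj c ≠ 0 := by simpa using hc0
  have hc' : conv h (adj h) = c • h := by rw [hG.conv_comm hf hb ha hb.adj, hc]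
  have hadj : adj h = (c / conj c) • h := by
    ext x
    have h1 := conv_adj_self_apply_inv h x⁻¹
    rw [hc', inv_inv] at h1
    simp only [ContinuousMap.smul_apply, smul_eq_mul, map_mul] at h1
    simp only [adj_apply, ContinuousMap.smul_apply, smul_eq_mul]
    field_simp
    linear_combination -h1
  -- The average `avg K y h` is an eigenvector of convolution by `adj h`; since `adj h` is
  -- proportional to `h`, commutativity makes it a multiple of `h` as well. Evaluation at 1 fixes
  -- the multiple.
  have hR (x y : G) : h 1 * ∫ k : K, h (x * k * y) ∂haarProb K = h x * h y := by
    obtain ⟨d, hd⟩ := heig _ (hf.avg (K := K) y) (hb.avg y)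
    have h1 : c • avg K y h = (c / conj c * d) • h := by
      have e1 : conv (adj h) (avg K y h) = c • avg K y h := by
        rw [conv_avg, hc]
        exact (avgL K y).map_smul c h
      rw [← e1, ← hG.conv_comm (hf.avg y) (hb.avg y) ha hb.adj, hadj]
      rw [← convL_apply, map_smul, convL_apply, hd, smul_smul]
    have h2 (x : G) : c * avg K y h x = c / conj c * d * h x := by
      simpa using congrArg (fun p : C(G, ℂ) => p x) h1
    have h3 : avg K y h 1 = h y := by
      rw [avg_apply]
      simp [(hb _ (Subtype.prop _) _).1]
    have h4 := h2 1
    rw [h3] at h4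
    rw [← avg_apply]
    apply mul_left_cancel₀ hc0
    linear_combination h 1 * h2 x - h x * h4
  refine ⟨(h 1)⁻¹ • h, ⟨by simp [h10], fun x y => ?_⟩, h 1, h10, by rw [smul_smul]; simp [h10]⟩
  simp only [ContinuousMap.smul_apply, smul_eq_mul, integral_const_mul]
  have := hR x y
  field_simp
  linear_combination this

/-- A bi-invariant function of finite type that is orthogonal to all spherical functions vanishes. -/
theorem IsGelfand.eq_zero_of_forall_conv_eq_zero (hG : IsGelfand K) (hf : LFin f) (hb : BiInv K f)
    (h0 : ∀ φ, IsSph K φ → conv f φ = 0) : f = 0 := by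
  by_contra hne
  obtain ⟨V, hV, hVl, hfV⟩ := id hf
  let U : Submodule ℂ C(G, ℂ) :=
    { carrier := {h | h ∈ V ∧ BiInv K h ∧ ∀ φ, IsSph K φ → conv h φ = 0}
      zero_mem' := ⟨V.zero_mem, fun k hk x => by simp, fun φ _ => (convR φ).map_zero⟩
      add_mem' := fun {a b} ha hb => ⟨V.add_mem ha.1 hb.1, ha.2.1.add hb.2.1, fun φ hφ => by
        rw [← convR_apply, map_add, convR_apply, convR_apply, ha.2.2 φ hφ, hb.2.2 φ hφ, add_zero]⟩
      smul_mem' := fun c a ha => ⟨V.smul_mem c ha.1, ha.2.1.smul c, fun φ hφ => by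
        rw [← convR_apply, map_smul, convR_apply, ha.2.2 φ hφ, smul_zero]⟩ }
  have hUV : U ≤ V := fun h hh => hh.1
  have : FiniteDimensional ℂ U := Submodule.finiteDimensional_of_le hUV
  have hU : U ≠ ⊥ := fun h => hne ((Submodule.eq_bot_iff _).1 h f ⟨hfV, hb, h0⟩)
  -- The functions in `V` killed by all spherical functions form an invariant space. A common
  -- eigenvector there would be a multiple of some `φ`, yet `conv φ φ` is nonzero.
  obtain ⟨h, hh, hh0, heig⟩ := LieLocal.exists_common_eigenvector
    (fun g : {g : C(G, ℂ) // LFin g ∧ BiInv K g} => convL g.1) U hU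
    (fun g h hh => ⟨conv_mem hVl _ hh.1, g.2.2.conv hh.2.1, fun φ hφ => by
      rw [convL_apply, conv_assoc, hh.2.2 φ hφ]; exact (convL g.1).map_zero⟩)
    (fun g g' h _ => by
      simp only [convL_apply]
      rw [← conv_assoc, hG.conv_comm g.2.1 g.2.2 g'.2.1 g'.2.2, conv_assoc])
  obtain ⟨φ, hφ, c, hc, rfl⟩ := hG.exists_isSph_of_eigenvector ⟨V, hV, hVl, hh.1⟩ hh.2.1 hh0
    fun f hf hb => heig ⟨f, hf, hb⟩
  have h1 := hh.2.2 φ hφ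
  rw [← convR_apply, map_smul, convR_apply, hφ.conv_self, smul_smul] at h1
  have h2 := hφ.nsq_pos.ne'
  simp [hφ.ne_zero, hc, h2] at h1

theorem linearIndependent_isSph : LinearIndependent ℂ fun φ : {φ : C(G, ℂ) // IsSph K φ} => φ.1 := by
  rw [linearIndependent_iff']
  intro s c hs i hi
  have h1 := congrArg (convR i.1) hs
  rw [map_sum, map_zero, Finset.sum_eq_single i] at h1
  · rw [map_smul, convR_apply, i.2.conv_self, smul_smul] at h1
    have h2 := i.2.nsq_pos.ne'
    simpa [i.2.ne_zero, h2] using h1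
  · intro j _ hj
    rw [map_smul, convR_apply, j.2.conv_eq_zero i.2 (fun h => hj (Subtype.ext h)), smul_zero]
  · exact fun h => absurd hi h

/-- Convolving `φ` with `f` gives `ip f φ • φ`, which stays in the finite-dimensional space carrying
`f`. Every `φ` that occurs thus lies in that space, and these functions are linearly independent. -/
theorem IsGelfand.finite_ip_ne_zero (hG : IsGelfand K) (hf : LFin f) (hb : BiInv K f) :
    {φ : {φ : C(G, ℂ) // IsSph K φ} | ip f φ.1 ≠ 0}.Finite := by
  obtain ⟨V, hV, hVl, hfV⟩ := id hf
  have hmem (φ : {φ : C(G, ℂ) // IsSph K φ}) (h : ip f φ.1 ≠ 0) : φ.1 ∈ V := by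
    have h1 := conv_mem hVl φ.1 hfV
    rw [← hG.conv_comm hf hb φ.2.lFin φ.2.biInv, φ.2.conv_eq hb] at h1
    exact (V.smul_mem_iff h).1 h1
  have hli : LinearIndependent ℂ
      fun φ : {φ : {φ : C(G, ℂ) // IsSph K φ} | ip f φ.1 ≠ 0} => (⟨φ.1.1, hmem φ.1 φ.2⟩ : V) := by
    apply LinearIndependent.of_comp V.subtype
    exact (linearIndependent_isSph (K := K)).comp _ Subtype.val_injective
  have := hli.finite_of_isNoetherian
  exact Set.toFinite _

/-- The expansion of a bi-invariant function of finite type in spherical functions. -/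
theorem IsGelfand.eq_sum (hG : IsGelfand K) (hf : LFin f) (hb : BiInv K f)
    (S : Finset {φ : C(G, ℂ) // IsSph K φ}) (hS : ∀ φ, φ ∉ S → ip f φ.1 = 0) :
    f = ∑ φ ∈ S, (ip f φ.1 / nsq φ.1) • φ.1 := by
  classical
  have hsum : ∀ T : Finset {φ : C(G, ℂ) // IsSph K φ},
      LFin (f - ∑ φ ∈ T, (ip f φ.1 / nsq φ.1) • φ.1) ∧
      BiInv K (f - ∑ φ ∈ T, (ip f φ.1 / nsq φ.1) • φ.1) := by
    intro T
    induction T using Finset.induction_on with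
    | empty => simpa using ⟨hf, hb⟩
    | insert φ T hφ ih =>
      rw [Finset.sum_insert hφ, add_comm, ← sub_sub, sub_eq_add_neg, ← neg_smul]
      exact ⟨ih.1.add (φ.2.lFin.smul _), ih.2.add (φ.2.biInv.smul _)⟩
  refine sub_eq_zero.1 (hG.eq_zero_of_forall_conv_eq_zero (hsum S).1 (hsum S).2 fun ψ hψ => ?_)
  rw [← convR_apply, map_sub, map_sum, convR_apply, hψ.conv_eq hb]
  have hz (φ : {φ : C(G, ℂ) // IsSph K φ}) (h : φ ≠ ⟨ψ, hψ⟩) :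
      convR ψ ((ip f φ.1 / nsq φ.1) • φ.1) = 0 := by
    rw [map_smul, convR_apply, φ.2.conv_eq_zero hψ (fun h' => h (Subtype.ext h')), smul_zero]
  have hself : convR ψ ((ip f ψ / nsq ψ) • ψ) = ip f ψ • ψ := by
    have h2 : (nsq ψ : ℂ) ≠ 0 := by exact_mod_cast hψ.nsq_pos.ne'
    rw [map_smul, convR_apply, hψ.conv_self, smul_smul, div_mul_cancel₀ _ h2]
  by_cases h : (⟨ψ, hψ⟩ : {φ : C(G, ℂ) // IsSph K φ}) ∈ S
  · rw [Finset.sum_eq_single_of_mem _ h fun φ _ => hz φ, hself, sub_self]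
  · rw [Finset.sum_eq_zero fun φ hφ => hz φ (fun e => h (e ▸ hφ))]
    have := hS _ h
    simp only at this
    rw [this]; simp

end

/-! ### The exchangeable pair and the square of W -/

section

variable {G : Type*} [Group G] [TopologicalSpace G] [IsTopologicalGroup G] [CompactSpace G]
  [MeasurableSpace G] [BorelSpace G] {K : Subgroup G} [CompactSpace K] {t φ ψ f h : C(G, ℂ)}

theorem isSph_one : IsSph K (1 : C(G, ℂ)) := ⟨rfl, fun x y => by simp⟩

theorem nsq_one : nsq (1 : C(G, ℂ)) = 1 := by simp [nsq]

theorem IsSph.isSph_star (hφ : IsSph K φ) : IsSph K (star φ) := ⟨by simp [hφ.1], fun x y => by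
  have := congrArg conj (hφ.2 x y)
  rw [← integral_conj] at this
  simpa using this⟩

theorem IsSph.im_eq_zero (hφ : IsSph K φ) {α : G}
    (hα : DoubleCoset.doubleCoset α (K : Set G) K = DoubleCoset.doubleCoset α⁻¹ (K : Set G) K) :
    (φ α).im = 0 := by
  obtain ⟨k, hk, k', hk', h⟩ : ∃ k ∈ K, ∃ k' ∈ K, α = k * α⁻¹ * k' := by
    have := DoubleCoset.mem_doubleCoset_self K K α
    rw [hα] at this
    exact DoubleCoset.mem_doubleCoset.1 this
  have h1 : φ α = φ α⁻¹ := by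
    conv_lhs => rw [h, (hφ.biInv k' hk' _).2, (hφ.biInv k hk _).1]
  rw [hφ.apply_inv] at h1
  exact Complex.conj_eq_iff_im.1 h1.symm

/-- The pair `(x, x α)` is exchangeable modulo right translations by `K`. -/
theorem integral_mul_comp_mul_comm {α : G}
    (hα : DoubleCoset.doubleCoset α (K : Set G) K = DoubleCoset.doubleCoset α⁻¹ (K : Set G) K)
    {A B : G → ℝ} (hA : ∀ k ∈ K, ∀ x, A (x * k) = A x) (hB : ∀ k ∈ K, ∀ x, B (x * k) = B x) :
    ∫ x, A x * B (x * α) ∂haarProb G = ∫ x, A (x * α) * B x ∂haarProb G := by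
  obtain ⟨k, hk, k', hk', h⟩ : ∃ k ∈ K, ∃ k' ∈ K, α⁻¹ = k * α * k' := by
    have := DoubleCoset.mem_doubleCoset_self K K α⁻¹
    rw [← hα] at this
    exact DoubleCoset.mem_doubleCoset.1 this
  rw [← integral_mul_right_eq_self (fun x => A (x * α) * B x) α⁻¹]
  rw [← integral_mul_right_eq_self (fun x => A (x * α⁻¹ * α) * B (x * α⁻¹)) k⁻¹]
  refine integral_congr_ae (Eventually.of_forall fun x => ?_)
  simp only [inv_mul_cancel_right, hA _ (K.inv_mem hk)]
  rw [h, ← mul_assoc, ← mul_assoc, hB k' hk', inv_mul_cancel_right]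

/-- The conditional expectation of `φ (x * α)` given the coset of `x`, stated weakly. Reality of `φ
α` lets it pass to real parts. -/
theorem IsSph.integral_mul_re_comp_mul (hφ : IsSph K φ) {α : G} (hα : (φ α).im = 0) {A : G → ℝ}
    (hA : Continuous A) (hK : ∀ k ∈ K, ∀ x, A (x * k) = A x) :
    ∫ x, A x * (φ (x * α)).re ∂haarProb G = (φ α).re * ∫ x, A x * (φ x).re ∂haarProb G := by
  have h := hφ.integral_mul_comp_mul (f := fun x => (A x : ℂ)) (by fun_prop)
    (fun k hk x => by rw [hK k hk]) α
  have hre {q : G → ℂ} (hq : Continuous q) :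
      (∫ x, (A x : ℂ) * q x ∂haarProb G).re = ∫ x, A x * (q x).re ∂haarProb G := by
    have := integral_re (μ := haarProb G) (𝕜 := ℂ) (f := fun x => (A x : ℂ) * q x)
      (integrable_haarProb (by fun_prop))
    simpa using this.symm
  have h1 := congrArg Complex.re h
  rw [hre (by fun_prop), Complex.mul_re, hα, mul_zero, sub_zero, hre (by fun_prop)] at h1
  rw [h1, mul_comm]

/-- The square of `t + conj t`. -/
def sq (t : C(G, ℂ)) : C(G, ℂ) := (t + star t) * (t + star t)

theorem sq_apply (t : C(G, ℂ)) (x : G) : sq t x = (((2 * (t x).re) ^ 2 : ℝ) : ℂ) := by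
  have : t x + conj (t x) = ((2 * (t x).re : ℝ) : ℂ) := Complex.add_conj _
  change (t x + conj (t x)) * (t x + conj (t x)) = _
  rw [this]
  push_cast
  ring

theorem IsSph.lFin_sq (ht : IsSph K t) : LFin (sq t) :=
  (ht.lFin.add ht.isSph_star.lFin).mul (ht.lFin.add ht.isSph_star.lFin)

theorem IsSph.biInv_sq (ht : IsSph K t) : BiInv K (sq t) :=
  (ht.biInv.add ht.isSph_star.biInv).mul (ht.biInv.add ht.isSph_star.biInv)

/-- Inversion conjugates `φ` and fixes the real function `sq t`, while preserving Haar measure. -/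
theorem IsSph.ip_sq_im (ht : IsSph K t) (hφ : IsSph K φ) : (ip (sq t) φ).im = 0 := by
  rw [← Complex.conj_eq_iff_im, ip, ← integral_conj, ← integral_inv_eq_self]
  simp only [map_mul, sq_apply, Complex.conj_ofReal, Complex.conj_conj, hφ.apply_inv, ht.apply_inv,
    Complex.conj_re]

/-- The coefficients of the square of `wfun t` in its expansion in spherical functions. -/
def coef (t φ : C(G, ℂ)) : ℝ := (ip (sq t) φ).re / (2 * nsq t * nsq φ)

/-- The real part of `t`, normalised to have unit `L²` norm when `t ≠ star t`. -/
def wfun (t : C(G, ℂ)) (x : G) : ℝ := √((nsq t)⁻¹ / 2) * (t x + conj (t x)).re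

theorem continuous_wfun (t : C(G, ℂ)) : Continuous (wfun t) := by unfold wfun; fun_prop

theorem wfun_eq (t : C(G, ℂ)) (x : G) : wfun t x = √((nsq t)⁻¹ / 2) * 2 * (t x).re := by
  rw [wfun, Complex.add_conj, Complex.ofReal_re]; ring

theorem IsSph.wfun_mul (ht : IsSph K t) : ∀ k ∈ K, ∀ x, wfun t (x * k) = wfun t x :=
  fun k hk x => by rw [wfun, wfun, (ht.biInv k hk x).2]

theorem IsSph.wfun_sq (ht : IsSph K t) (x : G) :
    wfun t x ^ 2 = (2 * nsq t)⁻¹ * (2 * (t x).re) ^ 2 := by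
  have := ht.nsq_pos
  rw [wfun_eq, mul_assoc, mul_pow, Real.sq_sqrt (by positivity), mul_inv, div_eq_mul_inv,
    mul_comm (2 : ℝ)⁻¹]

theorem IsGelfand.wfun_sq_eq_sum (hG : IsGelfand K) (ht : IsSph K t)
    (S : Finset {φ : C(G, ℂ) // IsSph K φ}) (hS : ∀ φ, φ ∉ S → ip (sq t) φ.1 = 0) (x : G) :
    wfun t x ^ 2 = ∑ φ ∈ S, coef t φ.1 * (φ.1 x).re := by
  have h := congrArg (fun p : C(G, ℂ) => (p x).re) (hG.eq_sum ht.lFin_sq ht.biInv_sq S hS)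
  simp only [sq_apply, Complex.ofReal_re, ContinuousMap.sum_apply, Complex.re_sum,
    ContinuousMap.smul_apply, smul_eq_mul] at h
  rw [ht.wfun_sq, h, Finset.mul_sum]
  refine Finset.sum_congr rfl fun φ _ => ?_
  have e : ip (sq t) φ.1 / nsq φ.1 = (((ip (sq t) φ.1).re / nsq φ.1 : ℝ) : ℂ) := by
    push_cast
    rw [← Complex.re_add_im (ip (sq t) φ.1), ht.ip_sq_im φ.2]
    simp
  have h0 := ht.nsq_pos.ne'
  have h1 := φ.2.nsq_pos.ne'
  rw [e, Complex.re_ofReal_mul, coef]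
  field_simp

theorem IsSph.integral_wfun_sq_mul (ht : IsSph K t) (hφ : IsSph K φ) :
    ∫ x, wfun t x ^ 2 * (φ x).re ∂haarProb G = coef t φ * nsq φ := by
  have h0 := ht.nsq_pos.ne'
  have h1 := hφ.nsq_pos.ne'
  have h := integral_re (μ := haarProb G) (𝕜 := ℂ) (f := fun x => sq t x * conj (φ x))
    (integrable_haarProb (by fun_prop))
  have e (x : G) : RCLike.re (sq t x * conj (φ x)) = (2 * (t x).re) ^ 2 * (φ x).re := by
    rw [sq_apply]
    exact Complex.re_ofReal_mul _ _
  simp only [e] at h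
  simp only [ht.wfun_sq, mul_assoc]
  rw [integral_const_mul]
  have e2 : ∫ x, (2 * (t x).re) ^ 2 * (φ x).re ∂haarProb G = (ip (sq t) φ).re := h
  rw [e2, coef]
  field_simp

/-- The squares of `t` and of `star t` integrate to zero because these distinct spherical functions
are orthogonal; only the cross term survives. Non-reality of τ enters here and gives W variance 1.
-/
theorem IsSph.ip_sq_one (ht : IsSph K t) (him : t ≠ star t) : ip (sq t) 1 = 2 * nsq t := by
  have h1 : ip t (star t) = 0 := ht.ip_eq_zero ht.isSph_star him
  have h2 : ip (star t) t = 0 := ht.isSph_star.ip_eq_zero ht him.symm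
  have h3 := ip_self t
  rw [ip] at h1 h2 h3
  have e (x : G) : sq t x * conj ((1 : C(G, ℂ)) x) =
      t x * conj (star t x) + (star t x) * conj (t x) + (2 : ℂ) * (t x * conj (t x)) := by
    simp [sq]; ring
  rw [ip]
  simp only [e]
  rw [integral_add (integrable_haarProb (by fun_prop)) (integrable_haarProb (by fun_prop)),
    integral_add (integrable_haarProb (by fun_prop)) (integrable_haarProb (by fun_prop)),
    integral_const_mul, h1, h2, h3]
  simp

theorem IsSph.coef_one (ht : IsSph K t) (him : t ≠ star t) : coef t 1 = 1 := by
  have h0 := ht.nsq_pos.ne'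
  rw [coef, ht.ip_sq_one him, nsq_one]
  simp [h0]

theorem IsSph.integral_wfun_sq (ht : IsSph K t) (him : t ≠ star t) :
    ∫ x, wfun t x ^ 2 ∂haarProb G = 1 := by
  have := ht.integral_wfun_sq_mul (isSph_one (K := K))
  rw [ht.coef_one him, nsq_one] at this
  simpa using this

/-- Bessel's inequality for the real part of a combination of spherical functions. -/
theorem integral_sq_sum_le (S : Finset {φ : C(G, ℂ) // IsSph K φ})
    (b : {φ : C(G, ℂ) // IsSph K φ} → ℝ) :
    ∫ x, (∑ φ ∈ S, b φ * (φ.1 x).re) ^ 2 ∂haarProb G ≤ ∑ φ ∈ S, b φ ^ 2 * nsq φ.1 := by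
  classical
  set B : C(G, ℂ) := ∑ φ ∈ S, (b φ : ℂ) • φ.1 with hB
  have hBx (x : G) : B x = ∑ φ ∈ S, (b φ : ℂ) * φ.1 x := by simp [hB, ContinuousMap.sum_apply]
  have hn : nsq B = ∑ φ ∈ S, b φ ^ 2 * nsq φ.1 := by
    have h1 : ip B B = ∑ φ ∈ S, ∑ ψ ∈ S, (b φ : ℂ) * (b ψ : ℂ) * ip φ.1 ψ.1 := by
      have e (x : G) : B x * conj (B x) =
          ∑ φ ∈ S, ∑ ψ ∈ S, (b φ : ℂ) * (b ψ : ℂ) * (φ.1 x * conj (ψ.1 x)) := by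
        rw [hBx, map_sum, Finset.sum_mul_sum]
        refine Finset.sum_congr rfl fun φ _ => Finset.sum_congr rfl fun ψ _ => ?_
        rw [map_mul, Complex.conj_ofReal]
        ring
      rw [ip]
      simp only [e]
      rw [integral_finsetSum _ fun i _ => integrable_haarProb (by fun_prop)]
      refine Finset.sum_congr rfl fun φ _ => ?_
      rw [integral_finsetSum _ fun i _ => integrable_haarProb (by fun_prop)]
      simp only [integral_const_mul, ip]
    have h2 : ip B B = ∑ φ ∈ S, ((b φ ^ 2 * nsq φ.1 : ℝ) : ℂ) := by
      rw [h1]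
      refine Finset.sum_congr rfl fun φ hφ => ?_
      rw [Finset.sum_eq_single_of_mem φ hφ fun ψ _ h => ?_]
      · rw [ip_self]; push_cast; ring
      · rw [φ.2.ip_eq_zero ψ.2 (fun e => h (Subtype.ext e.symm)), mul_zero]
    rw [ip_self] at h2
    exact_mod_cast h2
  rw [← hn, nsq]
  refine integral_mono (integrable_haarProb (by fun_prop)) (integrable_haarProb (by fun_prop))
    fun x => ?_
  have : ∑ φ ∈ S, b φ * (φ.1 x).re = (B x).re := by
    rw [hBx, Complex.re_sum]
    simp
  simp only
  rw [this, ← sq_abs]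
  gcongr
  exact Complex.abs_re_le_norm _

end

/-! ### Moments of the pair and the normal approximation -/

section Core

variable {G : Type*} [Group G] [TopologicalSpace G] [IsTopologicalGroup G] [CompactSpace G]
  [MeasurableSpace G] [BorelSpace G] {K : Subgroup G} [CompactSpace K] {t φ ψ f h : C(G, ℂ)}

open scoped Classical in
/-- The normal approximation bound for `wfun t`, in terms of the expansion coefficients of its
square. -/
theorem IsGelfand.abs_measureReal_wfun_le_sub_cdf (hG : IsGelfand K) (ht : IsSph K t)
    (him : t ≠ star t) {α : G}
    (hα : DoubleCoset.doubleCoset α (K : Set G) K = DoubleCoset.doubleCoset α⁻¹ (K : Set G) K)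
    (hα1 : (t α).re ≠ 1) {a : ℝ} (ha : a = 1 - (t α).re)
    (S : Finset {φ : C(G, ℂ) // IsSph K φ}) (hS : ∀ φ, φ ∉ S → ip (sq t) φ.1 = 0) (x₀ : ℝ) :
    0 < a ∧ |(haarProb G).real {x | wfun t x ≤ x₀} - SteinGauss.cdf x₀| ≤
      1 / a * √(∑ φ ∈ S with φ.1 ≠ 1,
        (coef t φ.1 * ((φ.1 α).re - 1 + 2 * a)) ^ 2 * nsq φ.1) +
      (4 / (Real.pi * a) * ∑ φ ∈ S, coef t φ.1 ^ 2 * nsq φ.1 *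
        (2 * a - 3 / 2 * (1 - (φ.1 α).re))) ^ (1 / 4 : ℝ) := by
  set P := haarProb G
  set w := wfun t with hw
  have hwc : Continuous w := continuous_wfun t
  have hwK : ∀ k ∈ K, ∀ x, w (x * k) = w x := ht.wfun_mul
  have hsq := hG.wfun_sq_eq_sum ht S hS
  rw [← hw] at hsq
  have hreal (φ : {φ : C(G, ℂ) // IsSph K φ}) : (φ.1 α).im = 0 := φ.2.im_eq_zero hα
  -- the linear regression property
  have hlin {A : G → ℝ} (hA : Continuous A) (hK : ∀ k ∈ K, ∀ x, A (x * k) = A x) :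
      ∫ x, A x * w (x * α) ∂P = (1 - a) * ∫ x, A x * w x ∂P := by
    have h := ht.integral_mul_re_comp_mul (ht.im_eq_zero hα) hA hK
    have e (x : G) (y : G) : A x * w y = √((nsq t)⁻¹ / 2) * 2 * (A x * (t y).re) := by
      rw [hw, wfun_eq]; ring
    simp only [e]
    rw [integral_const_mul, integral_const_mul, h, ha]
    ring
  -- the conditional second moment
  have hcond {A : G → ℝ} (hA : Continuous A) (hK : ∀ k ∈ K, ∀ x, A (x * k) = A x) :
      ∫ x, A x * w (x * α) ^ 2 ∂P =
        ∑ φ ∈ S, coef t φ.1 * (φ.1 α).re * ∫ x, A x * (φ.1 x).re ∂P := by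
    simp only [hsq, Finset.mul_sum]
    rw [integral_finsetSum _ fun i _ => integrable_haarProb (by fun_prop)]
    refine Finset.sum_congr rfl fun φ _ => ?_
    have h := φ.2.integral_mul_re_comp_mul (hreal φ) hA hK
    simp only [mul_left_comm (A _) (coef t φ.1)]
    rw [integral_const_mul, h]
    ring
  have hinv {B : G → ℝ} : ∫ x, B (x * α) ∂P = ∫ x, B x ∂P := integral_mul_right_eq_self B α
  have hw2 : ∫ x, w x ^ 2 ∂P = 1 := ht.integral_wfun_sq him
  have hw2' : ∫ x, w (x * α) ^ 2 ∂P = 1 := by rw [hinv (B := fun x => w x ^ 2), hw2]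
  have hcross : ∫ x, w x * w (x * α) ∂P = 1 - a := by
    rw [hlin hwc hwK]
    simp only [← pow_two, hw2, mul_one]
  have i1 {B : G → ℝ} (hB : Continuous B) : Integrable B P := integrable_haarProb hB
  have hdelta2 : ∫ x, (w (x * α) - w x) ^ 2 ∂P = 2 * a := by
    have e (x : G) : (w (x * α) - w x) ^ 2 =
        w (x * α) ^ 2 - 2 * (w x * w (x * α)) + w x ^ 2 := by ring
    simp only [e]
    rw [integral_add (i1 (by fun_prop)) (i1 (by fun_prop)),
      integral_sub (i1 (by fun_prop)) (i1 (by fun_prop)), integral_const_mul, hw2, hw2', hcross]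
    ring
  -- `2 * a` is a second moment, hence nonnegative, and `hα1` excludes 0.
  have hapos : 0 < a := by
    have h0 : 0 ≤ 2 * a := by rw [← hdelta2]; exact integral_nonneg fun x => sq_nonneg _
    have h1 : a ≠ 0 := fun h => hα1 (by linarith)
    exact lt_of_le_of_ne (by linarith) h1.symm
  refine ⟨hapos, ?_⟩
  -- fourth moments
  set M := ∑ φ ∈ S, coef t φ.1 ^ 2 * nsq φ.1 with hM
  set N := ∑ φ ∈ S, coef t φ.1 ^ 2 * nsq φ.1 * (φ.1 α).re with hN
  have hw4 : ∫ x, w x ^ 4 ∂P = M := by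
    have e (x : G) : w x ^ 4 = ∑ φ ∈ S, coef t φ.1 * (w x ^ 2 * (φ.1 x).re) := by
      rw [show w x ^ 4 = w x ^ 2 * w x ^ 2 by ring]
      nth_rw 2 [hsq]
      rw [Finset.mul_sum]
      exact Finset.sum_congr rfl fun φ _ => by ring
    simp only [e]
    rw [integral_finsetSum _ fun i _ => integrable_haarProb (by fun_prop), hM]
    refine Finset.sum_congr rfl fun φ _ => ?_
    rw [integral_const_mul, ht.integral_wfun_sq_mul φ.2]
    ring
  have hw4' : ∫ x, w (x * α) ^ 4 ∂P = M := by rw [hinv (B := fun x => w x ^ 4), hw4]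
  have hw22 : ∫ x, w x ^ 2 * w (x * α) ^ 2 ∂P = N := by
    rw [hcond (by fun_prop) (fun k hk x => by rw [hwK k hk]), hN]
    refine Finset.sum_congr rfl fun φ _ => ?_
    rw [ht.integral_wfun_sq_mul φ.2]
    ring
  have hw31 : ∫ x, w x ^ 3 * w (x * α) ∂P = (1 - a) * M := by
    rw [hlin (by fun_prop) (fun k hk x => by rw [hwK k hk]), ← hw4]
    congr 2
  have hw13 : ∫ x, w (x * α) ^ 3 * w x ∂P = (1 - a) * M := by
    rw [← hw31]
    exact (integral_mul_comp_mul_comm hα (A := fun x => w x ^ 3) (B := w)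
      (fun k hk x => by simp only [hwK k hk]) hwK).symm
  -- In the binomial expansion the terms with exponents 3 and 1 use the linear regression, one of
  -- them after exchange; the (2, 2) term uses the regression of each spherical function.
  have hdelta4 : ∫ x, (w (x * α) - w x) ^ 4 ∂P = 2 * M - 8 * (1 - a) * M + 6 * N := by
    have e (x : G) : (w (x * α) - w x) ^ 4 = w (x * α) ^ 4 + w x ^ 4 -
        4 * (w (x * α) ^ 3 * w x + w x ^ 3 * w (x * α)) + 6 * (w x ^ 2 * w (x * α) ^ 2) := by ring
    simp only [e]
    rw [integral_add (i1 (by fun_prop)) (i1 (by fun_prop)),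
      integral_sub (i1 (by fun_prop)) (i1 (by fun_prop)),
      integral_add (i1 (by fun_prop)) (i1 (by fun_prop)), integral_const_mul, integral_const_mul,
      integral_add (i1 (by fun_prop)) (i1 (by fun_prop)), hw4, hw4', hw22, hw31, hw13]
    ring
  set Q := ∑ φ ∈ S, coef t φ.1 ^ 2 * nsq φ.1 * (2 * a - 3 / 2 * (1 - (φ.1 α).re)) with hQ
  have hQ4 : ∫ x, (w (x * α) - w x) ^ 4 ∂P = 4 * Q := by
    rw [hdelta4, hM, hN, hQ, Finset.mul_sum, Finset.mul_sum, Finset.mul_sum, Finset.mul_sum,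
      ← Finset.sum_sub_distrib, ← Finset.sum_add_distrib]
    exact Finset.sum_congr rfl fun φ _ => by ring
  have hQ0 : 0 ≤ Q := by
    have : 0 ≤ ∫ x, (w (x * α) - w x) ^ 4 ∂P := integral_nonneg fun x => by positivity
    linarith
  -- Cauchy–Schwarz with the cube split as first power times square.
  have hdelta3 : ∫ x, |w (x * α) - w x| ^ 3 ∂P ≤ √(2 * a) * √(4 * Q) := by
    have m1 : MemLp (fun x => w (x * α) - w x) 2 P :=
      Continuous.memLp_of_hasCompactSupport (by fun_prop) (HasCompactSupport.of_compactSpace _)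
    have m2 : MemLp (fun x => (w (x * α) - w x) ^ 2) 2 P :=
      Continuous.memLp_of_hasCompactSupport (by fun_prop) (HasCompactSupport.of_compactSpace _)
    have h := SteinGauss.abs_integral_mul_le_sqrt_mul_sqrt m1 m2
    simp only [← pow_mul, Nat.reduceMul] at h
    rw [hdelta2, hQ4] at h
    refine le_trans (le_of_eq (integral_congr_ae (Eventually.of_forall fun x => ?_))) h
    simp only [abs_pow]
    ring
  -- Stein's theorem
  set s : G → ℝ := fun x => ∑ φ ∈ S, coef t φ.1 * ((φ.1 α).re - 1 + 2 * a) * (φ.1 x).re with hs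
  have hsc : Continuous s := by rw [hs]; fun_prop
  obtain ⟨C₁, hC₁⟩ := isCompact_univ.exists_bound_of_continuousOn hwc.continuousOn
  obtain ⟨C₂, hC₂⟩ := isCompact_univ.exists_bound_of_continuousOn hsc.continuousOn
  have hstein := SteinGauss.abs_measureReal_sub_cdf_le P (X := w) (Y := fun x => w (x * α)) (S := s)
    (a := a) (B := max C₁ C₂) hapos hwc.measurable (by fun_prop) hsc.measurable
    (fun x => (hC₁ x trivial).trans (le_max_left _ _))
    (fun x => (hC₁ _ trivial).trans (le_max_left _ _))
    (fun x => (hC₂ x trivial).trans (le_max_right _ _))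
    (fun u v hu hv => integral_mul_comp_mul_comm hα (A := fun x => u (w x)) (B := fun x => v (w x))
      (fun k hk x => by simp only [hwK k hk]) (fun k hk x => by simp only [hwK k hk]))
    (fun u hu => by
      simp only [mul_sub]
      rw [integral_sub (i1 (by fun_prop)) (i1 (by fun_prop)),
        hlin (A := fun x => u (w x)) (by fun_prop) (fun k hk x => by simp only [hwK k hk])]
      simp only [mul_comm (u _)]
      ring)
    (fun u hu => by
      have hA : Continuous fun x => u (w x) := by fun_prop
      have hAK : ∀ k ∈ K, ∀ x, u (w (x * k)) = u (w x) := fun k hk x => by rw [hwK k hk]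
      have e (x : G) : u (w x) * (w (x * α) - w x) ^ 2 = u (w x) * w (x * α) ^ 2 -
          2 * ((u (w x) * w x) * w (x * α)) + u (w x) * w x ^ 2 := by ring
      have e1 : ∫ x, u (w x) * w x * w x ∂P = ∫ x, u (w x) * w x ^ 2 ∂P := by
        congr 1; funext x; ring
      have e2 : ∫ x, u (w x) * w x ^ 2 ∂P =
          ∑ φ ∈ S, coef t φ.1 * ∫ x, u (w x) * (φ.1 x).re ∂P := by
        have (x : G) : u (w x) * w x ^ 2 = ∑ φ ∈ S, coef t φ.1 * (u (w x) * (φ.1 x).re) := by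
          rw [hsq, Finset.mul_sum]
          exact Finset.sum_congr rfl fun φ _ => by ring
        simp only [this]
        rw [integral_finsetSum _ fun i _ => integrable_haarProb (by fun_prop)]
        simp only [integral_const_mul]
        rfl
      have e3 : ∫ x, u (w x) * s x ∂P = ∑ φ ∈ S, coef t φ.1 * ((φ.1 α).re - 1 + 2 * a) *
          ∫ x, u (w x) * (φ.1 x).re ∂P := by
        simp only [hs, Finset.mul_sum]
        rw [integral_finsetSum _ fun i _ => integrable_haarProb (by fun_prop)]
        refine Finset.sum_congr rfl fun φ _ => ?_
        rw [← integral_const_mul]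
        congr 1; funext x; ring
      simp only [e]
      rw [integral_add (i1 (by fun_prop)) (i1 (by fun_prop)),
        integral_sub (i1 (by fun_prop)) (i1 (by fun_prop)), integral_const_mul,
        hlin (A := fun x => u (w x) * w x) (by fun_prop)
          (fun k hk x => by simp only [hwK k hk]), hcond hA hAK, e1, e2, e3]
      set Z : {φ : C(G, ℂ) // IsSph K φ} → ℝ := fun φ => ∫ x, u (w x) * (φ.1 x).re ∂P
      have e4 : ∑ φ ∈ S, coef t φ.1 * ((φ.1 α).re - 1 + 2 * a) * Z φ =
          ∑ φ ∈ S, coef t φ.1 * (φ.1 α).re * Z φ + (2 * a - 1) * ∑ φ ∈ S, coef t φ.1 * Z φ := by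
        rw [Finset.mul_sum, ← Finset.sum_add_distrib]
        exact Finset.sum_congr rfl fun φ _ => by ring
      rw [e4]
      ring) x₀
  refine hstein.trans (add_le_add ?_ ?_)
  · refine mul_le_mul_of_nonneg_left (Real.sqrt_le_sqrt ?_) (by positivity)
    -- The trivial function has coefficient 1 and value 1 at `α`, so its term is exactly `2 * a`;
    -- centring removes it and produces the starred sum.
    have e (x : G) : s x - 2 * a = ∑ φ ∈ S with φ.1 ≠ 1,
        coef t φ.1 * ((φ.1 α).re - 1 + 2 * a) * (φ.1 x).re := by
      have h1S : (⟨1, isSph_one⟩ : {φ : C(G, ℂ) // IsSph K φ}) ∈ S := by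
        by_contra h
        have h2 := hS _ h
        rw [ht.ip_sq_one him] at h2
        have := ht.nsq_pos.ne'
        simp [this] at h2
      have h3 : s x = _ := (Finset.sum_filter_add_sum_filter_not S (fun φ => φ.1 ≠ 1) _).symm
      have h4 : S.filter (fun φ => ¬ φ.1 ≠ 1) = {⟨1, isSph_one⟩} := by
        ext φ
        simp only [ne_eq, not_not, Finset.mem_filter, Finset.mem_singleton, Subtype.ext_iff]
        exact ⟨fun h => h.2, fun h => ⟨by rwa [show φ = ⟨1, isSph_one⟩ from Subtype.ext h], h⟩⟩
      rw [h3, h4, Finset.sum_singleton, ht.coef_one him]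
      simp
    simp only [e]
    exact integral_sq_sum_le _ _
  · have hm := SteinGauss.mass_pos
    have h1 : SteinGauss.mass⁻¹ * ((∫ x, |w (x * α) - w x| ^ 3 ∂P) / a) ≤
        √(4 / (Real.pi * a) * Q) := by
      calc _ ≤ SteinGauss.mass⁻¹ * (√(2 * a) * √(4 * Q) / a) := by gcongr
        _ = √(4 / (Real.pi * a) * Q) := by
          rw [SteinGauss.mass, ← Real.sqrt_mul_self (show
            0 ≤ (√(2 * Real.pi))⁻¹ * (√(2 * a) * √(4 * Q) / a) by positivity)]
          congr 1
          have h2 : (√(2 * Real.pi)) ^ 2 = 2 * Real.pi := Real.sq_sqrt (by positivity)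
          have h3 : (√(2 * a)) ^ 2 = 2 * a := Real.sq_sqrt (by positivity)
          have h4 : (√(4 * Q)) ^ 2 = 4 * Q := Real.sq_sqrt (by positivity)
          calc _ = ((√(2 * Real.pi)) ^ 2)⁻¹ * ((√(2 * a)) ^ 2 * (√(4 * Q)) ^ 2 / a ^ 2) := by
                ring
            _ = _ := by
                rw [h2, h3, h4]
                field_simp
    refine (Real.sqrt_le_sqrt h1).trans (le_of_eq ?_)
    rw [Real.sqrt_eq_rpow, Real.sqrt_eq_rpow, ← Real.rpow_mul (by positivity)]
    norm_num

end Core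

/-! ### Passage between `G` and `G ⧸ K` -/

section

variable {G : Type*} [Group G] [TopologicalSpace G] [IsTopologicalGroup G] [CompactSpace G]
  [MeasurableSpace G] [BorelSpace G] {K : Subgroup G} [CompactSpace K]

/-- Functions on `G ⧸ K`, regarded as functions on `G`. -/
def pull (K : Subgroup G) : C(G ⧸ K, ℂ) →ₗ[ℂ] C(G, ℂ) where
  toFun f := f.comp ⟨fun g => (g : G ⧸ K), QuotientGroup.continuous_mk⟩
  map_add' _ _ := rfl
  map_smul' _ _ := rfl

@[simp]
theorem pull_apply (f : C(G ⧸ K, ℂ)) (x : G) : pull K f x = f (x : G ⧸ K) := rfl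

theorem pull_injective : Function.Injective (pull K) := fun f h hfh => by
  ext p
  obtain ⟨x, rfl⟩ := QuotientGroup.mk_surjective p
  exact congrArg (fun q : C(G, ℂ) => q x) hfh

theorem pull_sq (f : C(G ⧸ K, ℂ)) : pull K ((f + star f) ^ 2) = sq (pull K f) := by
  rw [pow_two]; rfl

theorem isSph_pull_iff {f : C(G ⧸ K, ℂ)} : IsSph K (pull K f) ↔ IsSpherical K f := Iff.rfl

/-- Spherical functions on `G ⧸ K` correspond to spherical functions on `G`. -/
def sphEquiv (K : Subgroup G) [CompactSpace K] :
    SphericalFunction K ≃ {φ : C(G, ℂ) // IsSph K φ} :=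
  Equiv.ofBijective (fun f => ⟨pull K f.1, isSph_pull_iff.2 f.2⟩) <| by
    refine ⟨fun f h hfh => Subtype.ext (pull_injective (congrArg Subtype.val hfh)), fun φ => ?_⟩
    have hφ : ∀ a b : G, QuotientGroup.leftRel K a b → φ.1 a = φ.1 b := fun a b hab => by
      rw [QuotientGroup.leftRel_apply] at hab
      rw [← (φ.2.biInv _ hab a).2, mul_inv_cancel_left]
    let f : C(G ⧸ K, ℂ) := ⟨Quotient.lift φ.1 hφ, φ.1.continuous.quotient_lift hφ⟩
    have hf : pull K f = φ.1 := rfl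
    exact ⟨⟨f, isSph_pull_iff.1 (hf ▸ φ.2)⟩, rfl⟩

theorem sphEquiv_coe (φ : SphericalFunction K) : (sphEquiv K φ).1 = pull K φ.1 := rfl

/-- The two spans live in different function spaces, so both are embedded in the plain functions on
`G`, where inverting the group element matches the generators. -/
theorem sphDim_eq_finrank (f : C(G ⧸ K, ℂ)) :
    sphDim f = Module.finrank ℂ (transl (pull K f)) := by
  let A : (G ⧸ K → ℂ) →ₗ[ℂ] (G → ℂ) := LinearMap.funLeft ℂ ℂ fun x : G => (x : G ⧸ K)
  let B : C(G, ℂ) →ₗ[ℂ] (G → ℂ) := ContinuousMap.coeFnLinearMap ℂ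
  have hA : Function.Injective A :=
    LinearMap.funLeft_injective_of_surjective ℂ ℂ _ QuotientGroup.mk_surjective
  have hB : Function.Injective B := DFunLike.coe_injective
  rw [sphDim, (Submodule.equivMapOfInjective A hA _).finrank_eq, transl,
    (Submodule.equivMapOfInjective B hB _).finrank_eq, Submodule.map_span, Submodule.map_span]
  suffices hset : A '' Set.range (fun (g : G) (p : G ⧸ K) => f (g • p)) =
      B '' Set.range (fun g : G => lt g (pull K f)) by rw [hset]
  ext q
  simp only [Set.mem_image, Set.mem_range, exists_exists_eq_and]
  constructor
  · rintro ⟨g, rfl⟩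
    exact ⟨g⁻¹, by
      funext x
      change f ((g⁻¹⁻¹ * x : G) : G ⧸ K) = f ((g * x : G) : G ⧸ K)
      rw [inv_inv]⟩
  · rintro ⟨g, rfl⟩
    exact ⟨g⁻¹, rfl⟩

theorem sphDim_eq_inv (φ : SphericalFunction K) : (sphDim φ.1 : ℝ) = (nsq (pull K φ.1))⁻¹ := by
  rw [sphDim_eq_finrank]
  exact eq_inv_of_mul_eq_one_left (isSph_pull_iff.2 φ.2).finrank_mul_nsq

theorem integral_quotientHaar {F : G ⧸ K → ℂ} (hF : Continuous F) :
    ∫ p, F p ∂quotientHaar K = ∫ g : G, F (g : G ⧸ K) ∂haarProb G := by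
  have hm : Measurable fun g : G => (g : G ⧸ K) := QuotientGroup.measurable_coe
  have hFm : Measurable F :=
    measurable_from_quotient.2 (hF.comp QuotientGroup.continuous_mk).measurable
  exact integral_map hm.aemeasurable hFm.aestronglyMeasurable

theorem mult_eq (τ φ : SphericalFunction K) : mult τ.1 2 φ.1 =
    √((nsq (pull K φ.1))⁻¹ * (nsq (pull K τ.1))⁻¹ ^ 2) *
      (ip (sq (pull K τ.1)) (pull K φ.1)).re := by
  rw [mult, sphDim_eq_inv, sphDim_eq_inv, integral_quotientHaar (by fun_prop), ip, ← pull_sq]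
  rfl

theorem mult_sq (τ φ : SphericalFunction K) :
    mult τ.1 2 φ.1 ^ 2 = 4 * (coef (pull K τ.1) (pull K φ.1) ^ 2 * nsq (pull K φ.1)) := by
  have h1 := (isSph_pull_iff.2 τ.2).nsq_pos
  have h2 := (isSph_pull_iff.2 φ.2).nsq_pos
  rw [mult_eq, mul_pow, Real.sq_sqrt (by positivity), coef]
  field_simp
  ring

theorem sqrt_mul_mult (τ φ : SphericalFunction K) :
    √((sphDim φ.1 : ℝ) / (sphDim τ.1 : ℝ) ^ 2) * mult τ.1 2 φ.1 =
      (ip (sq (pull K τ.1)) (pull K φ.1)).re / nsq (pull K φ.1) := by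
  have h1 := (isSph_pull_iff.2 τ.2).nsq_pos
  have h2 := (isSph_pull_iff.2 φ.2).nsq_pos
  rw [mult_eq, sphDim_eq_inv, sphDim_eq_inv, ← mul_assoc, ← Real.sqrt_mul (by positivity)]
  have : (nsq (pull K φ.1))⁻¹ / (nsq (pull K τ.1))⁻¹ ^ 2 *
      ((nsq (pull K φ.1))⁻¹ * (nsq (pull K τ.1))⁻¹ ^ 2) = ((nsq (pull K φ.1))⁻¹) ^ 2 := by
    field_simp
  rw [this, Real.sqrt_sq (by positivity)]
  ring

theorem mult_eq_zero_iff (τ φ : SphericalFunction K) :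
    mult τ.1 2 φ.1 = 0 ↔ ip (sq (pull K τ.1)) (pull K φ.1) = 0 := by
  have h1 := (isSph_pull_iff.2 τ.2).nsq_pos
  have h2 := (isSph_pull_iff.2 φ.2).nsq_pos
  have h3 := (isSph_pull_iff.2 τ.2).ip_sq_im (isSph_pull_iff.2 φ.2)
  have h4 : √((nsq (pull K φ.1))⁻¹ * (nsq (pull K τ.1))⁻¹ ^ 2) ≠ 0 := by positivity
  rw [mult_eq, mul_eq_zero, or_iff_right h4, Complex.ext_iff]
  simp [h3]

theorem measureReal_sphW (τ : SphericalFunction K) (x₀ : ℝ) :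
    (quotientHaar K).real {p | sphW τ.1 p ≤ x₀} =
      (haarProb G).real {x | wfun (pull K τ.1) x ≤ x₀} := by
  have hm : Measurable fun g : G => (g : G ⧸ K) := QuotientGroup.measurable_coe
  have e : (fun g : G => (g : G ⧸ K)) ⁻¹' {p | sphW τ.1 p ≤ x₀} =
      {x | wfun (pull K τ.1) x ≤ x₀} := by
    ext x
    simp only [Set.mem_preimage, Set.mem_ofPred_eq, sphW, wfun, sphDim_eq_inv, pull_apply]
  -- The σ-algebra on `G ⧸ K` is the quotient one, so measurability is tested on preimages in `G`.
  have hs : MeasurableSet {p : G ⧸ K | sphW τ.1 p ≤ x₀} := by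
    refine measurableSet_quotient.2 ?_
    exact e ▸ measurableSet_le (continuous_wfun _).measurable measurable_const
  rw [quotientHaar, map_measureReal_apply hm hs, e]

end

end CompactSymmetric

end

/-! ### The main theorem -/

open CompactSymmetric in
theorem mainTheorem4
    {E : Type*} [NormedAddCommGroup E] [NormedSpace ℝ E] [FiniteDimensional ℝ E]
    {G : Type*} [Group G] [TopologicalSpace G] [ChartedSpace E G] [IsTopologicalGroup G]
    [LieGroup 𝓘(ℝ, E) ∞ G] [T2Space G] [CompactSpace G] [ConnectedSpace G]
    [MeasurableSpace G] [BorelSpace G]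
    (K : Subgroup G) [CompactSpace K] (hK : IsSymmetricSubgroup K)
    (τ : SphericalFunction K) (hτ : ∃ p, (τ.1 p).im ≠ 0)
    (α : G) (hαK : α ∉ K)
    (hα : DoubleCoset.doubleCoset α (K : Set G) K = DoubleCoset.doubleCoset α⁻¹ (K : Set G) K)
    (hτα : τ.1 (α : G ⧸ K) ≠ 1)
    (a : ℝ) (ha : a = 1 - (τ.1 (α : G ⧸ K)).re) :
    -- the numbers `ω_φ(α)` are real
    (∀ φ : SphericalFunction K, (φ.1 (α : G ⧸ K)).im = 0) ∧
    -- the multiplicities are the coefficients in the expansion of `(τ + τ̄)²`, and only finitely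
    -- many are nonzero, so that the sums below are finite
    {φ : SphericalFunction K | mult τ.1 2 φ.1 ≠ 0}.Finite ∧
    HasSum
      (fun φ : SphericalFunction K =>
        ((√((sphDim φ.1 : ℝ) / (sphDim τ.1 : ℝ) ^ 2) * mult τ.1 2 φ.1 : ℝ) : ℂ) • φ.1)
      ((τ.1 + star τ.1) ^ 2) ∧
    ∀ x₀ : ℝ,
      |(quotientHaar K).real {p | sphW τ.1 p ≤ x₀}
          - 1 / √(2 * Real.pi) * ∫ x in Set.Iic x₀, Real.exp (-x ^ 2 / 2)| ≤
        1 / 2 * √(∑' φ : {φ : SphericalFunction K // φ.1 ≠ 1},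
            mult τ.1 2 φ.1.1 ^ 2 * (2 - 1 / a * (1 - (φ.1.1 (α : G ⧸ K)).re)) ^ 2)
        + (1 / Real.pi * ∑' φ : SphericalFunction K,
            mult τ.1 2 φ.1 ^ 2 * (2 - 3 / (2 * a) * (1 - (φ.1 (α : G ⧸ K)).re)))
              ^ (1 / 4 : ℝ) := by
  classical
  obtain ⟨σ, hσ, hinv, hle, hidx⟩ := hK
  have hKc : IsClosed (K : Set G) := (isCompact_iff_compactSpace.2 ‹_›).isClosed
  have hG : IsGelfand K := isGelfand_of_eventually hσ hinv (fun k hk => hle hk)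
    (LieLocal.eventually_exists_map_eq_mul_inv_mul E hKc hσ hinv hidx)
  set t := pull K τ.1 with ht'
  have ht : IsSph K t := isSph_pull_iff.2 τ.2
  have him : t ≠ star t := fun h => by
    obtain ⟨p, hp⟩ := hτ
    obtain ⟨x, rfl⟩ := QuotientGroup.mk_surjective p
    have h1 := congrArg (fun q : C(G, ℂ) => q x) h
    exact hp (Complex.conj_eq_iff_im.1 h1.symm)
  have hreal (φ : SphericalFunction K) : (φ.1 (α : G ⧸ K)).im = 0 :=
    (isSph_pull_iff.2 φ.2).im_eq_zero hα
  have hfin : {φ : SphericalFunction K | mult τ.1 2 φ.1 ≠ 0}.Finite := by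
    refine ((hG.finite_ip_ne_zero ht.lFin_sq ht.biInv_sq).preimage
      (sphEquiv K).injective.injOn).subset fun φ hφ => ?_
    exact fun h => hφ ((mult_eq_zero_iff τ φ).2 h)
  set S := hfin.toFinset with hSdef
  have hS0 (φ : SphericalFunction K) (h : φ ∉ S) : mult τ.1 2 φ.1 = 0 := by
    simpa [hSdef] using h
  set S' := S.map (sphEquiv K).toEmbedding with hS'
  have hS'0 (φ : {φ : C(G, ℂ) // IsSph K φ}) (h : φ ∉ S') : ip (sq t) φ.1 = 0 := by
    obtain ⟨φ, rfl⟩ := (sphEquiv K).surjective φ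
    refine (mult_eq_zero_iff τ φ).1 (hS0 φ fun h' => h ?_)
    exact Finset.mem_map_of_mem _ h'
  refine ⟨hreal, hfin, ?_, fun x₀ => ?_⟩
  · have hsum : (τ.1 + star τ.1) ^ 2 = ∑ φ ∈ S,
        ((√((sphDim φ.1 : ℝ) / (sphDim τ.1 : ℝ) ^ 2) * mult τ.1 2 φ.1 : ℝ) : ℂ) • φ.1 := by
      apply pull_injective (K := K)
      rw [pull_sq, hG.eq_sum ht.lFin_sq ht.biInv_sq S' hS'0, map_sum, hS', Finset.sum_map]
      refine Finset.sum_congr rfl fun φ _ => ?_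
      rw [sqrt_mul_mult, map_smul]
      congr 1
      have h3 := ht.ip_sq_im (isSph_pull_iff.2 φ.2)
      have h4 : ip (sq t) (pull K φ.1) = (((ip (sq t) (pull K φ.1)).re : ℝ) : ℂ) :=
        Complex.ext rfl (by simpa using h3)
      change ip (sq t) (pull K φ.1) / nsq (pull K φ.1) = _
      rw [h4]
      push_cast
      rw [Complex.ofReal_re]
    rw [hsum]
    exact hasSum_sum_of_ne_finset_zero fun φ hφ => by rw [hS0 φ hφ]; simp
  · have hα1 : (t α).re ≠ 1 := fun h => hτα (Complex.ext h (hreal τ))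
    obtain ⟨hapos, hmain⟩ := hG.abs_measureReal_wfun_le_sub_cdf ht him hα hα1 ha S' hS'0 x₀
    have ha0 := hapos.ne'
    have hcdf : 1 / √(2 * Real.pi) * ∫ x in Set.Iic x₀, Real.exp (-x ^ 2 / 2) =
        SteinGauss.cdf x₀ := by
      rw [SteinGauss.cdf, SteinGauss.mass, one_div]; rfl
    rw [measureReal_sphW, hcdf]
    refine hmain.trans (le_of_eq ?_)
    -- By `mult_sq` each squared multiplicity is 4 times a squared coefficient times a squared norm.
    -- The factor `4 / a ^ 2` is absorbed by `1 / 2` outside the root, leaving `1 / a`.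
    have e1 : ∑' φ : {φ : SphericalFunction K // φ.1 ≠ 1},
        mult τ.1 2 φ.1.1 ^ 2 * (2 - 1 / a * (1 - (φ.1.1 (α : G ⧸ K)).re)) ^ 2 =
        4 / a ^ 2 * ∑ φ ∈ S' with φ.1 ≠ 1,
          (coef t φ.1 * ((φ.1 α).re - 1 + 2 * a)) ^ 2 * nsq φ.1 := by
      refine (tsum_subtype {φ : SphericalFunction K | φ.1 ≠ 1} fun φ : SphericalFunction K =>
        mult τ.1 2 φ.1 ^ 2 * (2 - 1 / a * (1 - (φ.1 (α : G ⧸ K)).re)) ^ 2).trans ?_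
      rw [tsum_eq_sum (s := S) fun φ hφ => by
          by_cases h : φ.1 = 1 <;> simp [Set.indicator, hS0 φ hφ],
        Finset.sum_filter, hS', Finset.sum_map, Finset.mul_sum]
      refine Finset.sum_congr rfl fun φ _ => ?_
      have h1 : ((sphEquiv K φ).1 ≠ 1) ↔ φ.1 ≠ 1 := by
        rw [sphEquiv_coe]
        exact not_congr ((pull_injective (K := K)).eq_iff (b := 1))
      by_cases h : φ.1 = 1
      · simp [h, h1]
      · rw [Set.indicator_of_mem h, Equiv.toEmbedding_apply, if_pos (h1.2 h), mult_sq, sphEquiv_coe,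
          pull_apply]
        field_simp
        ring
    have e2 : ∑' φ : SphericalFunction K,
        mult τ.1 2 φ.1 ^ 2 * (2 - 3 / (2 * a) * (1 - (φ.1 (α : G ⧸ K)).re)) =
        4 / a * ∑ φ ∈ S', coef t φ.1 ^ 2 * nsq φ.1 * (2 * a - 3 / 2 * (1 - (φ.1 α).re)) := by
      rw [tsum_eq_sum (s := S) fun φ hφ => by simp [hS0 φ hφ], hS', Finset.sum_map, Finset.mul_sum]
      refine Finset.sum_congr rfl fun φ _ => ?_
      rw [Equiv.toEmbedding_apply, mult_sq, sphEquiv_coe, pull_apply, ← ht']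
      field_simp
    rw [e1, e2, Real.sqrt_mul (by positivity), Real.sqrt_div (by norm_num), Real.sqrt_sq hapos.le,
      show √(4 : ℝ) = 2 by rw [show (4 : ℝ) = 2 ^ 2 by norm_num]; exact Real.sqrt_sq (by norm_num),
      ← mul_assoc, ← mul_assoc]
    congr 1
    · field_simp
    · congr 2
      field_simp
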